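/- Let $$a(t)=\frac{16t^4+64t^3+76t^2+24t-1}{16(2t^2+4t+1)(t+1)},\qquad b(t)=\frac{16t(t+1)(t+2)(2t^2+4t+1)}{16t^4+64t^3+76t^2+24t-1},$$ $$c(t)=\frac{(t+1)(16t^4+64t^3+68t^2+8t+1)(16t^4+64t^3+100t^2+72t+17)}{4(16t^4+64t^3+76t^2+24t-1)(2t^2+4t+1)},$$ $$d(t)=\frac{256t^8+2048t^7+6272t^6+8960t^5+5424t^4+192t^3-888t^2-112t+33}{16(16t^4+64t^3+76t^2+24t-1)(2t^2+4t+1)(t+1)},$$ $$e(t)=\frac{N(t)}{16(16t^4+64t^3+76t^2+24t-1)(2t^2+4t+1)(t+1)},$$ where $$\begin{aligned}N(t)={}&4096t^{12}+49152t^{11}+262144t^{10}+819200t^9+1665024t^8+2310144t^7+2233728t^6\\&+1507584t^5+697856t^4+211968t^3+38624t^2+3520t+105.\end{aligned}$$ Then $b(t)d(t)e(t)\neq 0$ and $$E:\quad y^2=(b(t)x+1)(d(t)x+1)(e(t)x+1)$$ is an elliptic curve over $\mathbb{Q}(t)$, with the point at infinity as origin; the map $(x,y)\mapsto(b(t)d(t)e(t)\,x,\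 b(t)d(t)e(t)\,y)$ identifies it with its Weierstrass form $Y^2=(X+d(t)e(t))(X+b(t)e(t))(X+b(t)d(t))$. The torsion subgroup of $E(\mathbb{Q}(t))$ is isomorphic to $\mathbb{Z}/2\mathbb{Z}\times\mathbb{Z}/2\mathbb{Z}$, and the rank of $E(\mathbb{Q}(t))$ is at least $4$. More precisely, there are four points of $E(\mathbb{Q}(t))$ with $x$-coordinates $$0,\qquad a(t),\qquad c(t),\qquad \frac{1}{b(t)d(t)e(t)},$$ and they are linearly independent over $\mathbb{Z}$. -/

import Mathlib

namespace TripleCurve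

/-! The explicit rational functions, written as expressions in an element `t` of a field. The
theorem uses them at the indeterminate `t = RatFunc.X` of `ℚ(t) = RatFunc ℚ`. -/

section Functions

variable {K : Type*} [Field K]

/-- The function `a(t)`. -/
def a (t : K) : K :=
  (16 * t ^ 4 + 64 * t ^ 3 + 76 * t ^ 2 + 24 * t - 1) /
    (16 * (2 * t ^ 2 + 4 * t + 1) * (t + 1))

/-- The function `b(t)`. -/
def b (t : K) : K :=
  (16 * t * (t + 1) * (t + 2) * (2 * t ^ 2 + 4 * t + 1)) /
    (16 * t ^ 4 + 64 * t ^ 3 + 76 * t ^ 2 + 24 * t - 1)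

/-- The function `c(t)`. -/
def c (t : K) : K :=
  ((t + 1) * (16 * t ^ 4 + 64 * t ^ 3 + 68 * t ^ 2 + 8 * t + 1) *
      (16 * t ^ 4 + 64 * t ^ 3 + 100 * t ^ 2 + 72 * t + 17)) /
    (4 * (16 * t ^ 4 + 64 * t ^ 3 + 76 * t ^ 2 + 24 * t - 1) * (2 * t ^ 2 + 4 * t + 1))

/-- The function `d(t)`. -/
def d (t : K) : K :=
  (256 * t ^ 8 + 2048 * t ^ 7 + 6272 * t ^ 6 + 8960 * t ^ 5 + 5424 * t ^ 4 + 192 * t ^ 3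
      - 888 * t ^ 2 - 112 * t + 33) /
    (16 * (16 * t ^ 4 + 64 * t ^ 3 + 76 * t ^ 2 + 24 * t - 1) * (2 * t ^ 2 + 4 * t + 1) * (t + 1))

/-- The function `e(t)`. -/
def e (t : K) : K :=
  (4096 * t ^ 12 + 49152 * t ^ 11 + 262144 * t ^ 10 + 819200 * t ^ 9 + 1665024 * t ^ 8
      + 2310144 * t ^ 7 + 2233728 * t ^ 6 + 1507584 * t ^ 5 + 697856 * t ^ 4 + 211968 * t ^ 3
      + 38624 * t ^ 2 + 3520 * t + 105) /
    (16 * (16 * t ^ 4 + 64 * t ^ 3 + 76 * t ^ 2 + 24 * t - 1) * (2 * t ^ 2 + 4 * t + 1) * (t + 1))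

end Functions

section Model

variable {K : Type*} [Field K]

/-- The affine plane cubic `y² = (βx + 1)(δx + 1)(εx + 1)`. -/
def OnCubic (β δ ε x y : K) : Prop :=
  y ^ 2 = (β * x + 1) * (δ * x + 1) * (ε * x + 1)

/-- The Weierstrass model `Y² = (X + δε)(X + βε)(X + βδ)` of the cubic
`y² = (βx + 1)(δx + 1)(εx + 1)`. For `βδε ≠ 0` the two are isomorphic through
`X = βδε x`, `Y = βδε y` (see `onCubic_iff`). -/
def weierstrass (β δ ε : K) : WeierstrassCurve.Affine K where
  a₁ := 0
  a₂ := δ * ε + β * ε + β * δ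
  a₃ := 0
  a₄ := β * δ * ε * (β + δ + ε)
  a₆ := (β * δ * ε) ^ 2

theorem weierstrass_equation_iff (β δ ε X Y : K) :
    (weierstrass β δ ε).Equation X Y ↔
      Y ^ 2 = (X + δ * ε) * (X + β * ε) * (X + β * δ) := by
  rw [WeierstrassCurve.Affine.equation_iff]
  simp only [weierstrass]
  constructor <;> intro h <;> linear_combination h

/-- The coordinate change identifies the points of the cubic with those of its Weierstrass
model. -/
theorem onCubic_iff {β δ ε : K} (h : β * δ * ε ≠ 0) (x y : K) :
    OnCubic β δ ε x y ↔
      (weierstrass β δ ε).Equation (β * δ * ε * x) (β * δ * ε * y) := by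
  rw [weierstrass_equation_iff, OnCubic]
  constructor
  · intro hxy
    linear_combination (β * δ * ε) ^ 2 * hxy
  · intro hxy
    apply mul_left_cancel₀ (pow_ne_zero 2 h)
    linear_combination hxy

end Model

/-- The curve `y² = (b(t)x + 1)(d(t)x + 1)(e(t)x + 1)` over `ℚ(t)`, in Weierstrass form. -/
noncomputable def E : WeierstrassCurve.Affine (RatFunc ℚ) :=
  weierstrass (b RatFunc.X) (d RatFunc.X) (e RatFunc.X)

/-- The product `b(t) d(t) e(t)`, the scaling factor between the cubic and its Weierstrass form. -/
noncomputable def bde : RatFunc ℚ := b RatFunc.X * d RatFunc.X * e RatFunc.X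

/-- The `x`-coordinates `0`, `a(t)`, `c(t)`, `1 / (b(t) d(t) e(t))` on the cubic. -/
noncomputable def xCoord : Fin 4 → RatFunc ℚ :=
  ![0, a RatFunc.X, c RatFunc.X, 1 / bde]

end TripleCurve

/-!
Write `e₁ = -d e`, `e₂ = -b e`, `e₃ = -b d` for the roots of the Weierstrass model, so that the
curve is `y² = (x - e₁)(x - e₂)(x - e₃)` over `K = ℚ(t)`. Both assertions come from embedding `K`
in a completion of `ℚ`, by sending `t` to a transcendental number close to a chosen rational one.

*Torsion.* Under a suitable embedding of `K` in `ℚ_[2]`, with `t` near `-3/4`, a scaling of `x`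
puts the roots `e₂`, `e₃`, `e₁` at `0`, `δ`, `u` with `δ` exactly divisible by `4` and `u ≡ -1`
modulo `4`. The duplication formula shows that near infinity doubling multiplies the 2-adic
absolute value of `x` by `4`, so that points near infinity have infinite order
(`size_le_one_of_torsion`). If a point `Q ≠ 0` is a double, then `x(Q) - e₁`, `x(Q) - e₂`, `x(Q) -
e₃` are squares, and a case distinction on valuations puts `Q` or `2Q` near infinity, unless `2Q =
0`. Hence all torsion is killed by `4` (`four_nsmul_eq_zero_of_torsion`), and by `2` because the
nonzero points killed by `2` are not divisible by `2`, as the next argument shows.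

*Independence.* For a root `eᵢ`, the map `P ↦ x(P) - eᵢ` is a homomorphism from the group of points
to `Kˣ` modulo squares (`descentHom`). An embedding of `K` in `ℝ` turns it into a homomorphism to
`ℤ/2ℤ`, through the sign. The products of `b`, `d`, `e` with each other, and with `a` and with `c`,
become squares after adding `1`. Therefore the points with abscissae `a` and `c` differ from the
point with abscissa `0` by doubles `2 halfA` and `2 halfC`, and the point with abscissa `1 / (b d
e)` is a double `2 halfS` (`SplitBy.two_nsmul_half`, `some_eq_add_two_nsmul`). Six real embeddings
separate the classes modulo `2` of `halfA`, `halfC`, `halfS`, the point with abscissa `0` and two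
points of order two (`even_of_sum_eq`). So a relation modulo torsion between the first four of them
has even coefficients; as the torsion is killed by `2`, halving gives another such relation, and
infinite descent leaves only the trivial one.
-/

namespace TripleCurve

open WeierstrassCurve.Affine Filter Topology

/-! ### Curves with full two-torsion -/

section SplitCurve

variable {K : Type*} [Field K]

/-- `SplitBy W e₁ e₂ e₃` says that `W` is the curve `y² = (x - e₁)(x - e₂)(x - e₃)`; as the
condition is on the coefficients, the three roots may be permuted freely. -/
structure SplitBy (W : WeierstrassCurve.Affine K) (e₁ e₂ e₃ : K) : Prop where
  a₁ : W.a₁ = 0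
  a₂ : W.a₂ = -(e₁ + e₂ + e₃)
  a₃ : W.a₃ = 0
  a₄ : W.a₄ = e₁ * e₂ + e₁ * e₃ + e₂ * e₃
  a₆ : W.a₆ = -(e₁ * e₂ * e₃)

variable {W : WeierstrassCurve.Affine K} {e₁ e₂ e₃ : K}

theorem SplitBy.swap (h : SplitBy W e₁ e₂ e₃) : SplitBy W e₂ e₁ e₃ :=
  ⟨h.a₁, by rw [h.a₂]; ring, h.a₃, by rw [h.a₄]; ring, by rw [h.a₆]; ring⟩

theorem SplitBy.rotate (h : SplitBy W e₁ e₂ e₃) : SplitBy W e₂ e₃ e₁ :=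
  ⟨h.a₁, by rw [h.a₂]; ring, h.a₃, by rw [h.a₄]; ring, by rw [h.a₆]; ring⟩

theorem SplitBy.equation_iff (h : SplitBy W e₁ e₂ e₃) (x y : K) :
    W.Equation x y ↔ y ^ 2 = (x - e₁) * (x - e₂) * (x - e₃) := by
  rw [WeierstrassCurve.Affine.equation_iff, h.a₁, h.a₂, h.a₃, h.a₄, h.a₆]
  constructor <;> intro H <;> linear_combination H

theorem SplitBy.negY (h : SplitBy W e₁ e₂ e₃) (x y : K) : W.negY x y = -y := by
  simp [WeierstrassCurve.Affine.negY, h.a₁, h.a₃]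

theorem SplitBy.addX (h : SplitBy W e₁ e₂ e₃) (x₁ x₂ ℓ : K) :
    W.addX x₁ x₂ ℓ = ℓ ^ 2 + (e₁ + e₂ + e₃) - x₁ - x₂ := by
  rw [WeierstrassCurve.Affine.addX, h.a₁, h.a₂]; ring

theorem SplitBy.addY (h : SplitBy W e₁ e₂ e₃) (x₁ x₂ y₁ ℓ : K) :
    W.addY x₁ x₂ y₁ ℓ = -(ℓ * (ℓ ^ 2 + (e₁ + e₂ + e₃) - x₁ - x₂ - x₁) + y₁) := by
  rw [WeierstrassCurve.Affine.addY, h.negY, WeierstrassCurve.Affine.negAddY, h.addX]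

theorem SplitBy.Δ (h : SplitBy W e₁ e₂ e₃) :
    W.Δ = 16 * ((e₁ - e₂) * (e₁ - e₃) * (e₂ - e₃)) ^ 2 := by
  rw [WeierstrassCurve.Δ, WeierstrassCurve.b₂, WeierstrassCurve.b₄, WeierstrassCurve.b₆,
    WeierstrassCurve.b₈, h.a₁, h.a₂, h.a₃, h.a₄, h.a₆]
  ring

/-- The `x`-coordinate relation for three collinear points on the curve: the cubic of the curve
minus the square of the line has the three abscissae as its roots. -/
theorem SplitBy.line_identity [DecidableEq K] (h : SplitBy W e₁ e₂ e₃) {x₁ x₂ y₁ y₂ : K}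
    (h₁ : W.Equation x₁ y₁) (h₂ : W.Equation x₂ y₂) (hxy : ¬(x₁ = x₂ ∧ y₁ = W.negY x₂ y₂)) (z : K) :
    (z - e₁) * (z - e₂) * (z - e₃) - (W.slope x₁ x₂ y₁ y₂ * (z - x₁) + y₁) ^ 2 =
      (z - x₁) * (z - x₂) * (z - W.addX x₁ x₂ (W.slope x₁ x₂ y₁ y₂)) := by
  have H := congrArg (Polynomial.eval z) (addPolynomial_slope h₁ h₂ hxy)
  rw [addPolynomial_eq] at H
  simp only [Cubic.toPoly, h.a₁, h.a₂, h.a₃, h.a₄, h.a₆] at H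
  simp only [Polynomial.eval_neg, Polynomial.eval_add, Polynomial.eval_mul, Polynomial.eval_C,
    Polynomial.eval_pow, Polynomial.eval_X, Polynomial.eval_sub] at H
  linear_combination -H

variable [DecidableEq K]

/-- Addition of two points with distinct abscissae, through a given slope `ℓ`. -/
theorem SplitBy.add_eq (h : SplitBy W e₁ e₂ e₃) {x₁ x₂ x₃ y₁ y₂ y₃ ℓ : K}
    (h₁ : W.Nonsingular x₁ y₁) (h₂ : W.Nonsingular x₂ y₂) (h₃ : W.Nonsingular x₃ y₃)
    (hx : x₁ ≠ x₂) (hℓ : ℓ * (x₁ - x₂) = y₁ - y₂)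
    (hx₃ : x₃ = ℓ ^ 2 + (e₁ + e₂ + e₃) - x₁ - x₂) (hy₃ : y₃ = -(ℓ * (x₃ - x₁) + y₁)) :
    Point.some _ _ h₁ + Point.some _ _ h₂ = Point.some _ _ h₃ := by
  have hs : W.slope x₁ x₂ y₁ y₂ = ℓ := by
    rw [slope_of_X_ne hx, div_eq_iff (sub_ne_zero.2 hx), hℓ]
  rw [Point.add_of_X_ne hx, Point.some.injEq, hs, h.addX, h.addY]
  exact ⟨hx₃.symm, by rw [hy₃, hx₃]⟩

/-- Doubling of a point outside the two-torsion, through a given slope `ℓ` of the tangent. -/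
theorem SplitBy.double_eq (h : SplitBy W e₁ e₂ e₃) {x x' y y' ℓ : K}
    (h₁ : W.Nonsingular x y) (h₂ : W.Nonsingular x' y') (hy : 2 * y ≠ 0)
    (hℓ : ℓ * (2 * y) = (x - e₁) * (x - e₂) + (x - e₁) * (x - e₃) + (x - e₂) * (x - e₃))
    (hx' : x' = ℓ ^ 2 + (e₁ + e₂ + e₃) - x - x) (hy' : y' = -(ℓ * (x' - x) + y)) :
    (2 : ℕ) • Point.some _ _ h₁ = Point.some _ _ h₂ := by
  have hne : y ≠ W.negY x y := by
    rw [h.negY]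
    intro H
    exact hy (by linear_combination H)
  have hs : W.slope x x y y = ℓ := by
    rw [slope_of_Y_ne rfl hne, div_eq_iff (sub_ne_zero.2 hne), h.negY, h.a₁, h.a₂, h.a₄]
    linear_combination -hℓ
  rw [two_nsmul, Point.add_self_of_Y_ne hne, Point.some.injEq, hs, h.addX, h.addY]
  exact ⟨hx'.symm, by rw [hy', hx']⟩

/-- The double of a point of order other than two, with the duplication formula in the form
`x(2P) - e₁ = (((x - e₁)² - (e₁ - e₂)(e₁ - e₃)) / 2y)²`. -/
theorem SplitBy.exists_double (h : SplitBy W e₁ e₂ e₃) {x y : K} (h₁ : W.Nonsingular x y)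
    (hy : 2 * y ≠ 0) :
    ∃ (x' y' : K) (h₂ : W.Nonsingular x' y'), (2 : ℕ) • Point.some _ _ h₁ = Point.some _ _ h₂ ∧
      x' - e₁ = (((x - e₁) ^ 2 - (e₁ - e₂) * (e₁ - e₃)) / (2 * y)) ^ 2 := by
  have hne : y ≠ W.negY x y := by
    rw [h.negY]
    intro H
    exact hy (by linear_combination H)
  refine ⟨_, _, _, by rw [two_nsmul, Point.add_self_of_Y_ne hne], ?_⟩
  have hs : W.slope x x y y =
      ((x - e₁) * (x - e₂) + (x - e₁) * (x - e₃) + (x - e₂) * (x - e₃)) / (2 * y) := by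
    rw [slope_of_Y_ne rfl hne, h.negY, h.a₁, h.a₂, h.a₄]
    congr 1 <;> ring
  have he := (h.equation_iff x y).1 h₁.1
  rw [hs, h.addX, div_pow, div_pow, eq_div_iff (pow_ne_zero 2 hy), sub_mul, sub_mul, sub_mul,
    add_mul, div_mul_cancel₀ _ (pow_ne_zero 2 hy)]
  linear_combination (4 * (e₂ + e₃) - 8 * x) * he

/-- If `x - e₁ = u₁²`, `x - e₂ = u₂²`, `x - e₃ = u₃²` then the point `(x, u₁u₂u₃)` is twice the
point given by the classical bisection formula. -/
theorem SplitBy.two_nsmul_half (h : SplitBy W e₁ e₂ e₃) {x x' y y' u₁ u₂ u₃ : K}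
    (h₁ : W.Nonsingular x' y') (h₂ : W.Nonsingular x y) (hy : 2 * y' ≠ 0)
    (hu₁ : x - e₁ = u₁ ^ 2) (hu₂ : x - e₂ = u₂ ^ 2) (hu₃ : x - e₃ = u₃ ^ 2)
    (hx' : x' = x + u₁ * u₂ + u₁ * u₃ + u₂ * u₃)
    (hy' : y' = (u₁ + u₂) * (u₁ + u₃) * (u₂ + u₃)) (hyu : y = u₁ * u₂ * u₃) :
    (2 : ℕ) • Point.some _ _ h₁ = Point.some _ _ h₂ := by
  obtain rfl : e₁ = x - u₁ ^ 2 := by linear_combination -hu₁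
  obtain rfl : e₂ = x - u₂ ^ 2 := by linear_combination -hu₂
  obtain rfl : e₃ = x - u₃ ^ 2 := by linear_combination -hu₃
  subst hx' hy' hyu
  exact h.double_eq (ℓ := u₁ + u₂ + u₃) h₁ h₂ hy (by ring) (by ring) (by ring)

end SplitCurve

/-! ### The descent homomorphism attached to a quadratic character -/

section Descent

variable {K : Type*} [Field K]

open Classical in
/-- The value at a point `P` of the descent map attached to the root `e₁` and to a quadratic
character `χ`: it is `χ (x - e₁)`, where at the point `(e₁, 0)` the vanishing factor
`x - e₁` is replaced by `(e₁ - e₂)(e₁ - e₃)`. -/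
noncomputable def descentFun (χ : K → ZMod 2) (e₁ e₂ e₃ : K) {W : WeierstrassCurve.Affine K} :
    W.Point → ZMod 2
  | .zero => 0
  | .some x _ _ => if x = e₁ then χ ((e₁ - e₂) * (e₁ - e₃)) else χ (x - e₁)

variable {W : WeierstrassCurve.Affine K} {e₁ e₂ e₃ : K} {χ : K → ZMod 2}

theorem descentFun_root {y : K} (h : W.Nonsingular e₁ y) :
    descentFun χ e₁ e₂ e₃ (Point.some _ _ h) = χ ((e₁ - e₂) * (e₁ - e₃)) := by
  simp [descentFun]

theorem descentFun_some {x y : K} (h : W.Nonsingular x y) (hx : x ≠ e₁) :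
    descentFun χ e₁ e₂ e₃ (Point.some _ _ h) = χ (x - e₁) := by
  simp [descentFun, hx]

open Classical in
/-- The multiplicativity of the descent map on three collinear points, one of which may be the
two-torsion point `(e₁, 0)`. -/
theorem descent_collinear (hχ : ∀ a b : K, a ≠ 0 → b ≠ 0 → χ (a * b) = χ a + χ b)
    (h₁₂ : e₁ ≠ e₂) (h₁₃ : e₁ ≠ e₃) (h₂₃ : e₂ ≠ e₃) {x₁ x₂ x₃ ℓ m : K}
    (H : ∀ z, (z - e₁) * (z - e₂) * (z - e₃) - (ℓ * z + m) ^ 2 =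
      (z - x₁) * (z - x₂) * (z - x₃)) :
    (if x₃ = e₁ then χ ((e₁ - e₂) * (e₁ - e₃)) else χ (x₃ - e₁)) =
      (if x₁ = e₁ then χ ((e₁ - e₂) * (e₁ - e₃)) else χ (x₁ - e₁)) +
        (if x₂ = e₁ then χ ((e₁ - e₂) * (e₁ - e₃)) else χ (x₂ - e₁)) := by
  have two : ∀ a : ZMod 2, a + a = 0 := by decide
  have hnz : (e₁ - e₂) * (e₁ - e₃) ≠ 0 := mul_ne_zero (sub_ne_zero.2 h₁₂) (sub_ne_zero.2 h₁₃)
  -- If one abscissa is `e₁`, the other two satisfy `(x - e₁)(x' - e₁) = (e₁ - e₂)(e₁ - e₃)`.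
  have key : ∀ x x' : K, (∀ z, (z - e₁) * (z - e₂) * (z - e₃) - (ℓ * z + m) ^ 2 =
      (z - e₁) * (z - x) * (z - x')) → (x - e₁) * (x' - e₁) = (e₁ - e₂) * (e₁ - e₃) := by
    intro x x' Hx
    have hm : ℓ * e₁ + m = 0 := by
      have := Hx e₁
      simpa using this
    obtain rfl : m = -(ℓ * e₁) := by linear_combination hm
    have h2 : -ℓ ^ 2 * (e₂ - e₁) = (e₂ - x) * (e₂ - x') :=
      mul_left_cancel₀ (sub_ne_zero.2 h₁₂.symm) (by linear_combination Hx e₂)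
    have h3 : -ℓ ^ 2 * (e₃ - e₁) = (e₃ - x) * (e₃ - x') :=
      mul_left_cancel₀ (sub_ne_zero.2 h₁₃.symm) (by linear_combination Hx e₃)
    have h4 : -ℓ ^ 2 = e₂ + e₃ - x - x' :=
      mul_left_cancel₀ (sub_ne_zero.2 h₂₃) (by linear_combination h2 - h3)
    linear_combination -h2 + (e₂ - e₁) * h4
  by_cases c₁ : x₁ = e₁
  · subst c₁
    have hk := key _ _ H
    have ne₂ : x₂ ≠ x₁ := by rintro rfl; exact hnz (by rw [← hk]; ring)
    have ne₃ : x₃ ≠ x₁ := by rintro rfl; exact hnz (by rw [← hk]; ring)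
    rw [if_neg ne₃, if_pos rfl, if_neg ne₂, ← hk, hχ _ _ (sub_ne_zero.2 ne₂) (sub_ne_zero.2 ne₃),
      add_right_comm, two, zero_add]
  by_cases c₂ : x₂ = e₁
  · subst c₂
    have hk := key x₁ x₃ fun z => by rw [H]; ring
    have ne₃ : x₃ ≠ x₂ := by rintro rfl; exact hnz (by rw [← hk]; ring)
    rw [if_neg ne₃, if_pos rfl, if_neg c₁, ← hk, hχ _ _ (sub_ne_zero.2 c₁) (sub_ne_zero.2 ne₃),
      ← add_assoc, two, zero_add]
  by_cases c₃ : x₃ = e₁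
  · subst c₃
    have hk := key x₁ x₂ fun z => by rw [H]; ring
    rw [if_pos rfl, if_neg c₁, if_neg c₂, ← hk, hχ _ _ (sub_ne_zero.2 c₁) (sub_ne_zero.2 c₂)]
  · rw [if_neg c₁, if_neg c₂, if_neg c₃]
    have n₁ := sub_ne_zero.2 c₁
    have n₂ := sub_ne_zero.2 c₂
    have n₃ := sub_ne_zero.2 c₃
    have hsq : (x₁ - e₁) * (x₂ - e₁) * (x₃ - e₁) = (ℓ * e₁ + m) * (ℓ * e₁ + m) := by
      linear_combination H e₁
    have hl : ℓ * e₁ + m ≠ 0 := fun h0 =>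
      mul_ne_zero (mul_ne_zero n₁ n₂) n₃ (by rw [hsq, h0, zero_mul])
    have := congrArg χ hsq
    rw [hχ _ _ (mul_ne_zero n₁ n₂) n₃, hχ _ _ n₁ n₂, hχ _ _ hl hl, two] at this
    generalize χ (x₁ - e₁) = p at *
    generalize χ (x₂ - e₁) = q at *
    generalize χ (x₃ - e₁) = r at *
    revert p q r
    decide

/-- The descent map attached to the root `e₁` and to a quadratic character `χ`, as a homomorphism
on the group of points. -/
noncomputable def descentHom [DecidableEq K] (h : SplitBy W e₁ e₂ e₃)
    (hχ : ∀ a b : K, a ≠ 0 → b ≠ 0 → χ (a * b) = χ a + χ b)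
    (h₁₂ : e₁ ≠ e₂) (h₁₃ : e₁ ≠ e₃) (h₂₃ : e₂ ≠ e₃) : W.Point →+ ZMod 2 where
  toFun := descentFun χ e₁ e₂ e₃
  map_zero' := rfl
  map_add' := by
    have two : ∀ a : ZMod 2, a + a = 0 := by decide
    rintro (_ | ⟨x₁, y₁, h₁⟩) (_ | ⟨x₂, y₂, h₂⟩)
    · rfl
    · change descentFun χ e₁ e₂ e₃ (0 + Point.some _ _ h₂) = 0 + _
      rw [zero_add, zero_add]
    · change descentFun χ e₁ e₂ e₃ (Point.some _ _ h₁ + 0) = _ + 0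
      rw [add_zero, add_zero]
    · by_cases hxy : x₁ = x₂ ∧ y₁ = W.negY x₂ y₂
      · rw [Point.add_of_Y_eq hxy.1 hxy.2]
        obtain ⟨rfl, -⟩ := hxy
        exact (two _).symm
      · rw [Point.add_some hxy]
        refine descent_collinear hχ h₁₂ h₁₃ h₂₃ (ℓ := W.slope x₁ x₂ y₁ y₂)
          (m := y₁ - W.slope x₁ x₂ y₁ y₂ * x₁) fun z => ?_
        rw [← h.line_identity h₁.1 h₂.1 hxy z]
        ring

end Descent

/-! ### Duplication near infinity over the 2-adic numbers -/

section TwoAdic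

theorem norm_eq_one_or_le_half {p : ℚ_[2]} (hp : ‖p‖ ≤ 1) : ‖p‖ = 1 ∨ ‖p‖ ≤ 1 / 2 := by
  rcases hp.eq_or_lt with h | h
  · exact Or.inl h
  · right
    have := (Padic.norm_lt_pow_iff_norm_le_pow_sub_one (p := 2) p 0).1 (by simpa using h)
    norm_num at this ⊢
    exact this

theorem norm_two_padic : ‖(2 : ℚ_[2])‖ = 1 / 2 := by
  have := Padic.norm_p (p := 2)
  norm_num at this ⊢
  exact this

theorem norm_four_padic : ‖(4 : ℚ_[2])‖ = 1 / 4 := by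
  rw [show (4 : ℚ_[2]) = 2 * 2 by norm_num, norm_mul, norm_two_padic]; norm_num

theorem norm_add_le_padic {a b : ℚ_[2]} {r : ℝ} (ha : ‖a‖ ≤ r) (hb : ‖b‖ ≤ r) : ‖a + b‖ ≤ r :=
  (Padic.nonarchimedean a b).trans (max_le ha hb)

theorem norm_sub_le_padic {a b : ℚ_[2]} {r : ℝ} (ha : ‖a‖ ≤ r) (hb : ‖b‖ ≤ r) : ‖a - b‖ ≤ r := by
  rw [sub_eq_add_neg]
  exact norm_add_le_padic ha (by rwa [norm_neg])

theorem norm_sub_eq_left {a b : ℚ_[2]} (h : ‖b‖ < ‖a‖) : ‖a - b‖ = ‖a‖ := by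
  rw [sub_eq_add_neg, Padic.add_eq_max_of_ne (by rw [norm_neg]; exact h.ne'), norm_neg,
    max_eq_left h.le]

/-- Squares of 2-adic units are `1` modulo `4`. -/
theorem norm_sq_sub_one_le {p : ℚ_[2]} (hp : ‖p‖ = 1) : ‖p ^ 2 - 1‖ ≤ 1 / 4 := by
  have h1 : ‖p - 1‖ ≤ 1 / 2 := by
    -- The residue field has two elements, so the unit `p` reduces to `1`.
    obtain ⟨z, rfl⟩ : ∃ z : ℤ_[2], (z : ℚ_[2]) = p := ⟨⟨p, hp.le⟩, rfl⟩
    obtain ⟨n, hn, hmem⟩ := PadicInt.exists_mem_range (p := 2) z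
    rw [IsLocalRing.mem_maximalIdeal, PadicInt.mem_nonunits, PadicInt.norm_def,
      PadicInt.coe_sub, PadicInt.coe_natCast] at hmem
    interval_cases n
    · simp [hp] at hmem
    · have h := norm_eq_one_or_le_half (p := z - 1) (by simpa using hmem.le)
      exact h.resolve_left (by simpa using hmem.ne)
  have h2 : ‖p + 1‖ ≤ 1 / 2 := by
    rw [show p + 1 = (p - 1) + 2 by ring]
    exact norm_add_le_padic h1 norm_two_padic.le
  rw [show p ^ 2 - 1 = (p - 1) * (p + 1) by ring, norm_mul]
  nlinarith [norm_nonneg (p - 1), norm_nonneg (p + 1)]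

variable {δ u : ℚ_[2]}

theorem norm_eq_quarter (hδ : ‖δ - 4‖ ≤ 1 / 8) : ‖δ‖ = 1 / 4 := by
  rw [show δ = 4 - (4 - δ) by ring, norm_sub_eq_left, norm_four_padic]
  rw [norm_four_padic, norm_sub_rev]
  linarith

theorem norm_eq_one_of_near (hu : ‖u + 1‖ ≤ 1 / 4) : ‖u‖ = 1 := by
  rw [show u = (-1) - (-1 - u) by ring, norm_sub_eq_left] <;> simp only [norm_neg, norm_one]
  rw [show -1 - u = -(u + 1) by ring, norm_neg]
  linarith

/-- Close to the point at infinity, doubling multiplies the 2-adic size of the abscissa by `4`. -/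
theorem norm_double_of_one_lt (hδ : ‖δ - 4‖ ≤ 1 / 8) (hu : ‖u + 1‖ ≤ 1 / 4) {ξ ξ' η : ℚ_[2]}
    (hξ : 1 < ‖ξ‖) (he : η ^ 2 = ξ * (ξ - δ) * (ξ - u))
    (hd : ξ' = ((ξ ^ 2 - δ * u) / (2 * η)) ^ 2) : ‖ξ'‖ = 4 * ‖ξ‖ := by
  have nδ := norm_eq_quarter hδ
  have nu := norm_eq_one_of_near hu
  have h1 : ‖ξ - δ‖ = ‖ξ‖ := norm_sub_eq_left (by linarith)
  have h2 : ‖ξ - u‖ = ‖ξ‖ := norm_sub_eq_left (by linarith)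
  have h3 : ‖ξ ^ 2 - δ * u‖ = ‖ξ‖ ^ 2 := by
    rw [norm_sub_eq_left, norm_pow]
    rw [norm_mul, norm_pow, nδ, nu]
    nlinarith
  have h4 : ‖η‖ ^ 2 = ‖ξ‖ ^ 3 := by
    rw [← norm_pow, he, norm_mul, norm_mul, h1, h2]; ring
  have h0 : ‖ξ‖ ≠ 0 := by linarith
  rw [hd, norm_pow, norm_div, norm_mul, h3, norm_two_padic, div_pow, mul_pow, h4]
  field_simp
  norm_num

/-- A point all of whose differences `ξ`, `ξ - δ`, `ξ - u` are squares is either close to infinity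
or its double is. -/
theorem one_lt_norm_or_one_lt_norm_double (hδ : ‖δ - 4‖ ≤ 1 / 8) (hu : ‖u + 1‖ ≤ 1 / 4)
    {ξ ξ' η p q r : ℚ_[2]} (hp : ξ = p ^ 2) (hr : ξ - δ = r ^ 2) (hq : ξ - u = q ^ 2)
    (hη : η ≠ 0) (he : η ^ 2 = ξ * (ξ - δ) * (ξ - u))
    (hd : ξ' = ((ξ ^ 2 - δ * u) / (2 * η)) ^ 2) : 1 < ‖ξ‖ ∨ 1 < ‖ξ'‖ := by
  have nδ := norm_eq_quarter hδ
  have nu := norm_eq_one_of_near hu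
  have le_one : ∀ z : ℚ_[2], ‖z ^ 2‖ ≤ 1 → ‖z‖ ≤ 1 := fun z hz => by
    rw [norm_pow] at hz
    exact (sq_le_one_iff₀ (norm_nonneg _)).1 hz
  have sq_le : ∀ z : ℚ_[2], ‖z‖ ≤ 1 / 2 → ‖z ^ 2‖ ≤ 1 / 4 := fun z hz => by
    rw [norm_pow]; nlinarith [norm_nonneg z]
  rcases lt_or_ge 1 ‖ξ‖ with h | h
  · exact Or.inl h
  right
  have hp1 : ‖p‖ ≤ 1 := le_one p (by rwa [← hp])
  have hq1 : ‖q‖ ≤ 1 := le_one q (by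
    rw [← hq]; exact norm_sub_le_padic h nu.le)
  have hr1 : ‖r‖ ≤ 1 := le_one r (by
    rw [← hr]; exact norm_sub_le_padic h (by rw [nδ]; norm_num))
  -- `ξ` is not a unit: otherwise `q² = ξ - u` would be `2` modulo `4`.
  have hp2 : ‖p‖ ≤ 1 / 2 := by
    refine (norm_eq_one_or_le_half hp1).resolve_left fun h1 => ?_
    have hq2 : ‖q ^ 2 - 2‖ ≤ 1 / 4 := by
      rw [show q ^ 2 - 2 = (p ^ 2 - 1) - (u + 1) by rw [← hq, ← hp]; ring]
      exact norm_sub_le_padic (norm_sq_sub_one_le h1) hu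
    rcases norm_eq_one_or_le_half hq1 with h2 | h2
    · have := norm_sub_le_padic (r := 1 / 2) (hq2.trans (by norm_num)) (b := -2)
        (by rw [norm_neg, norm_two_padic])
      rw [sub_neg_eq_add, sub_add_cancel, norm_pow, h2] at this
      norm_num at this
    · have := norm_sub_le_padic (sq_le q h2) hq2
      rw [sub_sub_cancel, norm_two_padic] at this
      norm_num at this
  have hr2 : ‖r‖ ≤ 1 / 2 := by
    refine (norm_eq_one_or_le_half hr1).resolve_left fun h1 => ?_
    have : ‖r ^ 2‖ ≤ 1 / 4 := by
      rw [← hr, hp]; exact norm_sub_le_padic (sq_le p hp2) nδ.le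
    rw [norm_pow, h1] at this
    norm_num at this
  -- `p / 2` and `r / 2` are not both units, as the difference of their squares is odd.
  have hpr : ‖p‖ ^ 2 * ‖r‖ ^ 2 ≤ 1 / 64 := by
    have half : ∀ z : ℚ_[2], ‖z / 2‖ = 2 * ‖z‖ := fun z => by
      rw [norm_div, norm_two_padic]; ring
    have h1 := norm_eq_one_or_le_half (p := p / 2) (by rw [half]; linarith)
    have h2 := norm_eq_one_or_le_half (p := r / 2) (by rw [half]; linarith)
    have hp0 := norm_nonneg p
    have hr0 := norm_nonneg r
    rcases h1 with h1 | h1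
    · rcases h2 with h2 | h2
      · exfalso
        have := norm_sub_le_padic (norm_sq_sub_one_le h1) (norm_sq_sub_one_le h2)
        rw [show (p / 2) ^ 2 - 1 - ((r / 2) ^ 2 - 1) = δ / 4 by
          linear_combination (hr - hp) / 4, norm_div, nδ, norm_four_padic] at this
        norm_num at this
      · rw [half] at h2
        have : ‖r‖ ^ 2 ≤ 1 / 16 := by nlinarith
        have : ‖p‖ ^ 2 ≤ 1 / 4 := by nlinarith
        nlinarith [sq_nonneg ‖r‖, sq_nonneg ‖p‖]
    · rw [half] at h1
      have : ‖p‖ ^ 2 ≤ 1 / 16 := by nlinarith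
      have : ‖r‖ ^ 2 ≤ 1 / 4 := by nlinarith
      nlinarith [sq_nonneg ‖r‖, sq_nonneg ‖p‖]
  have nξ : ‖ξ‖ ≤ 1 / 4 := by rw [hp]; exact sq_le p hp2
  have h2 : ‖ξ - u‖ = 1 := by
    rw [norm_sub_rev, norm_sub_eq_left, nu]; linarith
  have h3 : ‖ξ ^ 2 - δ * u‖ = 1 / 4 := by
    rw [norm_sub_rev, norm_sub_eq_left, norm_mul, nδ, nu, mul_one]
    rw [norm_mul, norm_pow, nδ, nu]
    nlinarith [norm_nonneg ξ]
  have h4 : ‖η‖ ^ 2 ≤ 1 / 64 := by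
    rw [← norm_pow, he, norm_mul, norm_mul, h2, hr, hp, norm_pow, norm_pow, mul_one]
    exact hpr
  have h5 : 0 < ‖η‖ ^ 2 := pow_pos (norm_pos_iff.2 hη) 2
  rw [hd, norm_pow, norm_div, norm_mul, h3, norm_two_padic, div_pow, mul_pow,
    one_lt_div (by positivity)]
  linarith

end TwoAdic

/-! ### Torsion points and 2-adic size -/

section Torsion

variable {K : Type*} [Field K] {W : WeierstrassCurve.Affine K} {e₁ e₂ e₃ : K}

/-- The 2-adic size of the abscissa of a point, measured from the root `e₁` and in the coordinate
scaled by `c²`; it is `0` at the origin. -/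
noncomputable def size (φ : K →+* ℚ_[2]) (c e₁ : K) {W : WeierstrassCurve.Affine K} : W.Point → ℝ
  | .zero => 0
  | .some x _ _ => ‖φ (c ^ 2 * (x - e₁))‖

theorem SplitBy.eq_root_of_y_eq_zero (h : SplitBy W e₁ e₂ e₃) {x y : K} (h₁ : W.Nonsingular x y)
    (hy : y = 0) : x = e₁ ∨ x = e₂ ∨ x = e₃ := by
  have := (h.equation_iff x y).1 h₁.1
  rw [hy, zero_pow two_ne_zero, eq_comm, mul_eq_zero, mul_eq_zero, sub_eq_zero, sub_eq_zero,
    sub_eq_zero, or_assoc] at this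
  exact this

theorem SplitBy.equation_padic (h : SplitBy W e₁ e₂ e₃) (φ : K →+* ℚ_[2]) (c : K) {x y : K}
    (h₁ : W.Nonsingular x y) :
    φ (c ^ 3 * y) ^ 2 = φ (c ^ 2 * (x - e₁)) *
      (φ (c ^ 2 * (x - e₁)) - φ (c ^ 2 * (e₂ - e₁))) *
      (φ (c ^ 2 * (x - e₁)) - φ (c ^ 2 * (e₃ - e₁))) := by
  rw [← map_sub, ← map_sub, ← map_mul, ← map_mul, ← map_pow]
  congr 1
  linear_combination c ^ 6 * (h.equation_iff x y).1 h₁.1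

variable [DecidableEq K]

theorem SplitBy.two_nsmul_eq_zero (h : SplitBy W e₁ e₂ e₃) {x y : K} (h₁ : W.Nonsingular x y)
    (hy : y = 0) : (2 : ℕ) • Point.some _ _ h₁ = 0 := by
  rw [two_nsmul, Point.add_self_of_Y_eq]
  rw [h.negY, hy, neg_zero]

/-- The duplication formula in the scaled 2-adic coordinates `ξ = φ (c² (x - e₁))`. -/
theorem SplitBy.exists_double_padic (h : SplitBy W e₁ e₂ e₃) (φ : K →+* ℚ_[2]) {c : K}
    (hc : c ≠ 0) {x y : K} (h₁ : W.Nonsingular x y) (hy : y ≠ 0) :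
    ∃ (x' y' : K) (h₂ : W.Nonsingular x' y'), (2 : ℕ) • Point.some _ _ h₁ = Point.some _ _ h₂ ∧
      φ (c ^ 2 * (x' - e₁)) = ((φ (c ^ 2 * (x - e₁)) ^ 2 -
        φ (c ^ 2 * (e₂ - e₁)) * φ (c ^ 2 * (e₃ - e₁))) / (2 * φ (c ^ 3 * y))) ^ 2 := by
  have two : (2 : K) ≠ 0 := fun h2 => by
    have := congrArg φ h2
    rw [map_ofNat, map_zero] at this
    exact two_ne_zero this
  obtain ⟨x', y', h₂, hP, hx'⟩ := h.exists_double h₁ (mul_ne_zero two hy)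
  refine ⟨x', y', h₂, hP, ?_⟩
  rw [hx', ← map_ofNat φ 2, ← map_pow, ← map_mul, ← map_sub, ← map_mul, ← map_div₀, ← map_pow]
  congr 1
  field_simp
  ring

variable {φ : K →+* ℚ_[2]} {c : K}

theorem size_two_nsmul (h : SplitBy W e₁ e₂ e₃) (hc : c ≠ 0)
    (hδ : ‖φ (c ^ 2 * (e₂ - e₁)) - 4‖ ≤ 1 / 8) (hu : ‖φ (c ^ 2 * (e₃ - e₁)) + 1‖ ≤ 1 / 4)
    {P : W.Point} (hP : 1 < size φ c e₁ P) :
    size φ c e₁ ((2 : ℕ) • P) = 4 * size φ c e₁ P := by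
  rcases P with _ | ⟨x, y, h₁⟩
  · exact absurd hP (by simp [size])
  have hξ : 1 < ‖φ (c ^ 2 * (x - e₁))‖ := hP
  have he := h.equation_padic φ c h₁
  have hy : y ≠ 0 := by
    rintro rfl
    rw [mul_zero, map_zero, zero_pow two_ne_zero, eq_comm, mul_eq_zero, mul_eq_zero,
      sub_eq_zero, sub_eq_zero] at he
    rcases he with (he | he) | he <;> rw [he] at hξ
    · rw [norm_zero] at hξ; linarith
    · rw [norm_eq_quarter hδ] at hξ; linarith
    · rw [norm_eq_one_of_near hu] at hξ; linarith
  obtain ⟨x', y', h₂, hQ, hd⟩ := h.exists_double_padic φ hc h₁ hy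
  rw [hQ]
  exact norm_double_of_one_lt hδ hu hξ he hd

/-- Points close to infinity in the 2-adic topology have infinite order: the sizes of their
successive doubles are all distinct. -/
theorem size_le_one_of_torsion (h : SplitBy W e₁ e₂ e₃) (hc : c ≠ 0)
    (hδ : ‖φ (c ^ 2 * (e₂ - e₁)) - 4‖ ≤ 1 / 8) (hu : ‖φ (c ^ 2 * (e₃ - e₁)) + 1‖ ≤ 1 / 4)
    {P : W.Point} (hP : IsOfFinAddOrder P) : size φ c e₁ P ≤ 1 := by
  by_contra! hlt
  have hpow : ∀ k : ℕ, size φ c e₁ (2 ^ k • P) = 4 ^ k * size φ c e₁ P := by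
    intro k
    induction k with
    | zero => simp
    | succ k ih =>
      have h4 : (1 : ℝ) ≤ 4 ^ k := one_le_pow₀ (by norm_num)
      rw [pow_succ', mul_smul, size_two_nsmul h hc hδ hu (by rw [ih]; nlinarith), ih]
      ring
  have hfin : (AddSubmonoid.multiples P : Set W.Point).Finite := finite_multiples.2 hP
  refine Set.infinite_of_injective_forall_mem (f := fun k : ℕ => 2 ^ k • P) ?_
    (fun k => (AddSubmonoid.mem_multiples_iff _ P).2 ⟨2 ^ k, rfl⟩) hfin
  intro k l hkl
  have hkl' := congrArg (size φ c e₁) hkl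
  simp only [hpow] at hkl'
  exact pow_right_injective₀ (by norm_num : (0 : ℝ) < 4) (by norm_num)
    (mul_right_cancel₀ (by linarith) hkl')

/-- Under the given 2-adic conditions on the roots, all torsion is killed by `4`: the double of a
torsion point `P` is divisible by two, so if `4 P` were nonzero then `2 P` or `4 P` would be close
to infinity. -/
theorem four_nsmul_eq_zero_of_torsion (h : SplitBy W e₁ e₂ e₃) (hc : c ≠ 0)
    (hδ : ‖φ (c ^ 2 * (e₂ - e₁)) - 4‖ ≤ 1 / 8) (hu : ‖φ (c ^ 2 * (e₃ - e₁)) + 1‖ ≤ 1 / 4)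
    {P : W.Point} (hP : IsOfFinAddOrder P) : (4 : ℕ) • P = 0 := by
  have two : (2 : K) ≠ 0 := fun h2 => by
    have := congrArg φ h2
    rw [map_ofNat, map_zero] at this
    exact two_ne_zero this
  have hP₂ : IsOfFinAddOrder ((2 : ℕ) • P) := hP.nsmul
  have hP₄ : IsOfFinAddOrder ((2 : ℕ) • (2 : ℕ) • P) := hP₂.nsmul
  rw [show (4 : ℕ) = 2 * 2 from rfl, mul_smul]
  rcases P with _ | ⟨x, y, h₁⟩
  · exact (congrArg _ (nsmul_zero 2)).trans (nsmul_zero 2)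
  by_cases hy : y = 0
  · rw [h.two_nsmul_eq_zero h₁ hy, nsmul_zero]
  obtain ⟨x', y', h₂, hQ, hd₁⟩ := h.exists_double h₁ (mul_ne_zero two hy)
  obtain ⟨x'₂, y'₂, h'₂, hQ₂, hd₂⟩ := h.swap.exists_double h₁ (mul_ne_zero two hy)
  obtain ⟨x'₃, y'₃, h'₃, hQ₃, hd₃⟩ := h.rotate.rotate.exists_double h₁ (mul_ne_zero two hy)
  obtain ⟨rfl, -⟩ := Point.some.inj (hQ.symm.trans hQ₂)
  obtain ⟨rfl, -⟩ := Point.some.inj (hQ.symm.trans hQ₃)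
  rw [hQ] at hP₂ hP₄ ⊢
  by_cases hy' : y' = 0
  · exact h.two_nsmul_eq_zero h₂ hy'
  obtain ⟨x'', y'', h₃, hR, hd⟩ := h.exists_double_padic φ hc h₂ hy'
  rw [hR] at hP₄
  have hη : φ (c ^ 3 * y') ≠ 0 := by
    rw [map_ne_zero]
    exact mul_ne_zero (pow_ne_zero 3 hc) hy'
  have sq : ∀ {z w : K}, z = w ^ 2 → φ (c ^ 2 * z) = φ (c * w) ^ 2 := fun hz => by
    rw [hz, ← map_pow, mul_pow]
  rcases one_lt_norm_or_one_lt_norm_double hδ hu (sq hd₁)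
    (by rw [← sq hd₂, ← map_sub]; congr 1; ring) (by rw [← sq hd₃, ← map_sub]; congr 1; ring)
    hη (h.equation_padic φ c h₂) hd with hlt | hlt
  · exact absurd (size_le_one_of_torsion h hc hδ hu hP₂) (not_le.2 hlt)
  · exact absurd (size_le_one_of_torsion h hc hδ hu hP₄) (not_le.2 hlt)

end Torsion

/-! ### Independence from parity of coefficients -/

section Independence

/-- If the coefficients of every relation modulo torsion are even, then by infinite descent there
is no nontrivial relation. -/
theorem linearIndependent_of_even {G ι : Type*} [AddCommGroup G] [Fintype ι] {Q : ι → G}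
    (H : ∀ m : ι → ℤ, IsOfFinAddOrder (∑ i, m i • Q i) → ∀ i, 2 ∣ m i) :
    LinearIndependent ℤ Q := by
  have key : ∀ (N : ℕ) (m : ι → ℤ), IsOfFinAddOrder (∑ i, m i • Q i) → ∀ i, 2 ^ N ∣ m i := by
    intro N
    induction N with
    | zero => intro m _ i; simp
    | succ N ih =>
      intro m hm i
      choose k hk using H m hm
      have hsum : ∑ i, m i • Q i = (2 : ℕ) • ∑ i, k i • Q i := by
        rw [Finset.smul_sum]
        refine Finset.sum_congr rfl fun i _ => ?_
        rw [hk i, mul_smul, ofNat_smul_eq_nsmul]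
      rw [hsum] at hm
      obtain ⟨j, hj⟩ := ih k (hm.of_nsmul two_ne_zero) i
      exact ⟨j, by rw [hk i, hj]; ring⟩
  rw [Fintype.linearIndependent_iff]
  intro m hm i
  by_contra h0
  have hdvd := key (m i).natAbs m (by rw [hm]; exact IsOfFinAddOrder.zero) i
  have hle := Int.le_of_dvd (abs_pos.2 h0) ((dvd_abs _ _).2 hdvd)
  have hlt : (m i).natAbs < 2 ^ (m i).natAbs := Nat.lt_two_pow_self
  rw [Int.abs_eq_natAbs] at hle
  exact absurd (by exact_mod_cast hle) (not_le.2 hlt)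

end Independence

/-! ### Embeddings of the field of rational functions -/

section Embedding

/-- Transcendental numbers are dense in `ℝ` and in `ℚ_[p]`. -/
theorem exists_transcendental (L : Type) [NontriviallyNormedField L] [CompleteSpace L]
    [Algebra ℚ L] {p : L → Prop} {t₀ : L} (hp : ∀ᶠ τ in 𝓝 t₀, p τ) :
    ∃ τ, p τ ∧ Transcendental ℚ τ := by
  obtain ⟨τ, h₁, h₂⟩ :=
    ((Algebraic.countable ℚ L).dense_compl L).inter_nhds_nonempty hp
  exact ⟨τ, h₂, h₁⟩

/-- An open condition on `t` which holds at a point of `L` is satisfied by the image of `t` under an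
embedding of `ℚ(t)` in `L`. -/
theorem exists_hom (L : Type) [NontriviallyNormedField L] [CompleteSpace L]
    [Algebra ℚ L] {p : L → Prop} {t₀ : L} (hp : ∀ᶠ τ in 𝓝 t₀, p τ) :
    ∃ φ : RatFunc ℚ →+* L, p (φ RatFunc.X) := by
  obtain ⟨τ, hτ, ht⟩ := exists_transcendental L hp
  refine ⟨IsFractionRing.lift (A := Polynomial ℚ) (g := (Polynomial.aeval τ).toRingHom)
    (transcendental_iff_injective.1 ht), ?_⟩
  rw [← RatFunc.algebraMap_X, IsFractionRing.lift_algebraMap]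
  simpa using hτ

/-- The sign of a real number, written additively. -/
noncomputable def signBit (x : ℝ) : ZMod 2 := if x < 0 then 1 else 0

theorem signBit_of_neg {x : ℝ} (h : x < 0) : signBit x = 1 := if_pos h

theorem signBit_of_pos {x : ℝ} (h : 0 < x) : signBit x = 0 := if_neg h.le.not_gt

theorem signBit_mul {x y : ℝ} (hx : x ≠ 0) (hy : y ≠ 0) :
    signBit (x * y) = signBit x + signBit y := by
  rcases hx.lt_or_gt with h | h <;> rcases hy.lt_or_gt with h' | h'
  · rw [signBit_of_pos (mul_pos_of_neg_of_neg h h'), signBit_of_neg h, signBit_of_neg h']; rfl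
  · rw [signBit_of_neg (mul_neg_of_neg_of_pos h h'), signBit_of_neg h, signBit_of_pos h']; rfl
  · rw [signBit_of_neg (mul_neg_of_pos_of_neg h h'), signBit_of_pos h, signBit_of_neg h']; rfl
  · rw [signBit_of_pos (mul_pos h h'), signBit_of_pos h, signBit_of_pos h']; rfl

theorem signBit_comp_mul {K : Type*} [Field K] (φ : K →+* ℝ) (a b : K) (ha : a ≠ 0) (hb : b ≠ 0) :
    signBit (φ (a * b)) = signBit (φ a) + signBit (φ b) := by
  rw [map_mul, signBit_mul] <;> rwa [map_ne_zero]

theorem eventually_signBit_eq {F : ℝ → ℝ} {t₀ : ℝ} (hF : ContinuousAt F t₀) (h0 : F t₀ ≠ 0) :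
    ∀ᶠ τ in 𝓝 t₀, signBit (F τ) = signBit (F t₀) := by
  rcases h0.lt_or_gt with h | h
  · filter_upwards [hF.eventually_lt_const h] with τ hτ
    rw [signBit_of_neg hτ, signBit_of_neg h]
  · filter_upwards [hF.eventually_const_lt h] with τ hτ
    rw [signBit_of_pos hτ, signBit_of_pos h]

end Embedding

/-! ### Half points from quadruples -/

section Halving

variable {K : Type*} [Field K] [DecidableEq K] {W : WeierstrassCurve.Affine K} {β δ ε : K}

/-- The factor `(r₁ + r₂)(r₁ + r₃)(1 - r₂)(1 - r₃) / x²`: the difference between the abscissa of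
the half point of `some_eq_add_two_nsmul` and the root of the cubic belonging to `r₁`. -/
def halfDiff (x r₁ r₂ r₃ : K) : K := (r₁ + r₂) * (r₁ + r₃) * (1 - r₂) * (1 - r₃) / x ^ 2

/-- The ordinate of the half point of `some_eq_add_two_nsmul`. -/
def halfY (x r₁ r₂ r₃ : K) : K :=
  (r₁ + r₂) * (r₁ + r₃) * (r₂ + r₃) * ((r₁ - 1) * (r₂ - 1) * (r₃ - 1)) / x ^ 3

omit [DecidableEq K] in
theorem halfY_ne_zero {x r₁ r₂ r₃ : K} (h₁ : halfDiff x r₁ r₂ r₃ ≠ 0)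
    (h₂ : halfDiff x r₂ r₁ r₃ ≠ 0) : halfY x r₁ r₂ r₃ ≠ 0 := by
  intro h
  have key : halfY x r₁ r₂ r₃ * ((r₁ + r₂) * (1 - r₃)) =
      -(x * halfDiff x r₁ r₂ r₃ * halfDiff x r₂ r₁ r₃) := by
    have hx : x ≠ 0 := by
      rintro rfl
      exact h₁ (by simp [halfDiff])
    simp only [halfY, halfDiff]
    field_simp
    ring
  rw [h, zero_mul, zero_eq_neg] at key
  have hx : x ≠ 0 := by
    rintro rfl
    exact h₁ (by simp [halfDiff])
  exact mul_ne_zero (mul_ne_zero hx h₁) h₂ key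

omit [DecidableEq K] in
/-- The abscissa of the half point is the same, whichever root it is measured from. -/
theorem halfDiff_swap {x r₁ r₂ r₃ : K} (hx : x ≠ 0) (hβ : x * β + 1 = r₁ ^ 2)
    (hδ : x * δ + 1 = r₂ ^ 2) (hε : x * ε + 1 = r₃ ^ 2) :
    -(δ * ε) + halfDiff x r₁ r₂ r₃ = -(β * ε) + halfDiff x r₂ r₁ r₃ := by
  obtain rfl : β = (r₁ ^ 2 - 1) / x := by rw [eq_div_iff hx]; linear_combination hβ
  obtain rfl : δ = (r₂ ^ 2 - 1) / x := by rw [eq_div_iff hx]; linear_combination hδ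
  obtain rfl : ε = (r₃ ^ 2 - 1) / x := by rw [eq_div_iff hx]; linear_combination hε
  simp only [halfDiff]
  field_simp
  ring

omit [DecidableEq K] in
theorem SplitBy.equation_half (h : SplitBy W (-(δ * ε)) (-(β * ε)) (-(β * δ)))
    {x r₁ r₂ r₃ : K} (hx : x ≠ 0) (hβ : x * β + 1 = r₁ ^ 2)
    (hδ : x * δ + 1 = r₂ ^ 2) (hε : x * ε + 1 = r₃ ^ 2) :
    W.Equation (-(δ * ε) + halfDiff x r₁ r₂ r₃) (halfY x r₁ r₂ r₃) := by
  obtain rfl : β = (r₁ ^ 2 - 1) / x := by rw [eq_div_iff hx]; linear_combination hβ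
  obtain rfl : δ = (r₂ ^ 2 - 1) / x := by rw [eq_div_iff hx]; linear_combination hδ
  obtain rfl : ε = (r₃ ^ 2 - 1) / x := by rw [eq_div_iff hx]; linear_combination hε
  rw [h.equation_iff]
  simp only [halfDiff, halfY]
  field_simp
  ring

/-- If `x` extends `{β, δ, ε}` to a quadruple whose products with `x` become squares
`r₁², r₂², r₃²` after adding `1`, then the point with abscissa `x` differs from the point with
abscissa `0` by twice an explicit point. -/
theorem some_eq_add_two_nsmul (h : SplitBy W (-(δ * ε)) (-(β * ε)) (-(β * δ))) (hΔ : W.Δ ≠ 0)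
    {x r₁ r₂ r₃ X Y : K} (hx : x ≠ 0) (hk : β * δ * ε ≠ 0) (hβ : x * β + 1 = r₁ ^ 2)
    (hδ : x * δ + 1 = r₂ ^ 2) (hε : x * ε + 1 = r₃ ^ 2)
    (hX : X = -(δ * ε) + halfDiff x r₁ r₂ r₃) (hY : Y = halfY x r₁ r₂ r₃)
    (hY0 : 2 * Y ≠ 0) (hP : W.Nonsingular 0 (-(β * δ * ε)))
    (hA : W.Nonsingular (β * δ * ε * x) (β * δ * ε * (r₁ * r₂ * r₃))) (hH : W.Nonsingular X Y) :
    Point.some _ _ hA = Point.some _ _ hP + (2 : ℕ) • Point.some _ _ hH := by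
  obtain rfl : β = (r₁ ^ 2 - 1) / x := by rw [eq_div_iff hx]; linear_combination hβ
  obtain rfl : δ = (r₂ ^ 2 - 1) / x := by rw [eq_div_iff hx]; linear_combination hδ
  obtain rfl : ε = (r₃ ^ 2 - 1) / x := by rw [eq_div_iff hx]; linear_combination hε
  have hN : W.Nonsingular 0 ((r₁ ^ 2 - 1) / x * ((r₂ ^ 2 - 1) / x) * ((r₃ ^ 2 - 1) / x)) := by
    have := (nonsingular_neg ..).2 hP
    rwa [h.negY, neg_neg] at this
  have hneg : Point.some _ _ hN = -Point.some _ _ hP := by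
    rw [Point.neg_some, Point.some.injEq, h.negY, neg_neg]
    exact ⟨rfl, rfl⟩
  have hD : W.Nonsingular (-((r₂ ^ 2 - 1) / x * ((r₃ ^ 2 - 1) / x)) + ((r₂ * r₃ - r₁) / x) ^ 2)
      ((r₂ * r₃ - r₁) / x * ((r₁ * r₃ - r₂) / x) * ((r₁ * r₂ - r₃) / x)) := by
    rw [← equation_iff_nonsingular_of_Δ_ne_zero hΔ, h.equation_iff]
    field_simp
    ring
  have h2 : (2 : ℕ) • Point.some _ _ hH = Point.some _ _ hD := by
    subst hX hY
    refine h.two_nsmul_half hH hD hY0 (u₁ := (r₂ * r₃ - r₁) / x) (u₂ := (r₁ * r₃ - r₂) / x)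
      (u₃ := (r₁ * r₂ - r₃) / x) ?_ ?_ ?_ ?_ ?_ rfl
    · ring
    · field_simp; ring
    · field_simp; ring
    · rw [halfDiff]; field_simp; ring
    · rw [halfY]; field_simp; ring
  have h3 : Point.some _ _ hA + Point.some _ _ hN = Point.some _ _ hD := by
    refine h.add_eq hA hN hD (ℓ := (r₁ * r₂ * r₃ - 1) / x) (mul_ne_zero hk hx) ?_ ?_ ?_
    · field_simp; ring
    · field_simp; ring
    · field_simp; ring
  rw [h2, ← h3, hneg]
  abel

end Halving

/-! ### Square roots of the products increased by one -/

section Functions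

variable {K : Type*} [Field K]

/-- The common factor `16 t⁴ + 64 t³ + 76 t² + 24 t - 1` of the denominators. -/
def quartic (t : K) : K := 16 * t ^ 4 + 64 * t ^ 3 + 76 * t ^ 2 + 24 * t - 1

/-- The common factor `2 t² + 4 t + 1` of the denominators. -/
def quadratic (t : K) : K := 2 * t ^ 2 + 4 * t + 1

/-- Non-vanishing of the denominators of `a`, `b`, `c`, `d`, `e`, and of the numerator of `c`. -/
structure Regular (t : K) : Prop where
  shift_ne : t + 1 ≠ 0
  quartic_ne : quartic t ≠ 0
  quadratic_ne : quadratic t ≠ 0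
  c_ne : c t ≠ 0

/-- A square root of `b(t) d(t) + 1`. -/
def rootBD (t : K) : K :=
  (16 * (t + 1) ^ 5 - 28 * (t + 1) ^ 3 + 13 * (t + 1)) / quartic t

/-- A square root of `b(t) e(t) + 1`. -/
def rootBE (t : K) : K :=
  (64 * (t + 1) ^ 7 - 96 * (t + 1) ^ 5 + 40 * (t + 1) ^ 3 - 7 * (t + 1)) / quartic t

/-- A square root of `d(t) e(t) + 1`. -/
def rootDE (t : K) : K :=
  (1024 * (t + 1) ^ 10 - 2816 * (t + 1) ^ 8 + 2368 * (t + 1) ^ 6 - 720 * (t + 1) ^ 4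
    + 92 * (t + 1) ^ 2 - 9) / (16 * (t + 1) * quadratic t * quartic t)

/-- A square root of `a(t) d(t) + 1`. -/
def rootAD (t : K) : K :=
  (16 * (t + 1) ^ 4 + 4 * (t + 1) ^ 2 - 3) / (16 * (t + 1) * quadratic t)

/-- A square root of `a(t) e(t) + 1`. -/
def rootAE (t : K) : K :=
  (64 * (t + 1) ^ 6 - 64 * (t + 1) ^ 4 + 16 * (t + 1) ^ 2 + 3) / (16 * (t + 1) * quadratic t)

/-- A square root of `c(t) b(t) + 1`. -/
def rootCB (t : K) : K :=
  (32 * (t + 1) ^ 6 - 40 * (t + 1) ^ 4 + 6 * (t + 1) ^ 2 + 3) / quartic t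

/-- A square root of `c(t) d(t) + 1`. -/
def rootCD (t : K) : K :=
  (256 * (t + 1) ^ 8 - 640 * (t + 1) ^ 6 + 496 * (t + 1) ^ 4 - 72 * (t + 1) ^ 2 - 15) /
    (8 * quadratic t * quartic t)

/-- A square root of `c(t) e(t) + 1`. -/
def rootCE (t : K) : K :=
  (1024 * (t + 1) ^ 10 - 1792 * (t + 1) ^ 8 + 832 * (t + 1) ^ 6 + 48 * (t + 1) ^ 4
    - 84 * (t + 1) ^ 2 + 15) / (8 * quadratic t * quartic t)

variable {t : K}

theorem a_eq : a t = quartic t / (16 * quadratic t * (t + 1)) := rfl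

theorem b_eq : b t = 16 * t * (t + 1) * (t + 2) * quadratic t / quartic t := rfl

theorem c_eq : c t = (t + 1) * (16 * t ^ 4 + 64 * t ^ 3 + 68 * t ^ 2 + 8 * t + 1) *
    (16 * t ^ 4 + 64 * t ^ 3 + 100 * t ^ 2 + 72 * t + 17) / (4 * quartic t * quadratic t) := rfl

theorem d_eq : d t = (256 * t ^ 8 + 2048 * t ^ 7 + 6272 * t ^ 6 + 8960 * t ^ 5 + 5424 * t ^ 4
    + 192 * t ^ 3 - 888 * t ^ 2 - 112 * t + 33) / (16 * quartic t * quadratic t * (t + 1)) := rfl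

theorem e_eq : e t = (4096 * t ^ 12 + 49152 * t ^ 11 + 262144 * t ^ 10 + 819200 * t ^ 9
    + 1665024 * t ^ 8 + 2310144 * t ^ 7 + 2233728 * t ^ 6 + 1507584 * t ^ 5 + 697856 * t ^ 4
    + 211968 * t ^ 3 + 38624 * t ^ 2 + 3520 * t + 105) /
      (16 * quartic t * quadratic t * (t + 1)) := rfl

variable [CharZero K]

theorem b_mul_d_add_one (h : Regular t) : b t * d t + 1 = rootBD t ^ 2 := by
  have h₁ := h.shift_ne
  have h₂ := h.quartic_ne
  have h₃ := h.quadratic_ne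
  rw [b_eq, d_eq, rootBD]
  field_simp
  simp only [quartic]
  ring

theorem b_mul_e_add_one (h : Regular t) : b t * e t + 1 = rootBE t ^ 2 := by
  have h₁ := h.shift_ne
  have h₂ := h.quartic_ne
  have h₃ := h.quadratic_ne
  rw [b_eq, e_eq, rootBE]
  field_simp
  simp only [quartic]
  ring

theorem d_mul_e_add_one (h : Regular t) : d t * e t + 1 = rootDE t ^ 2 := by
  have h₁ := h.shift_ne
  have h₂ := h.quartic_ne
  have h₃ := h.quadratic_ne
  rw [d_eq, e_eq, rootDE]
  field_simp
  simp only [quartic, quadratic]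
  ring

theorem a_mul_b_add_one (h : Regular t) : a t * b t + 1 = (t + 1) ^ 2 := by
  have h₁ := h.shift_ne
  have h₂ := h.quartic_ne
  have h₃ := h.quadratic_ne
  rw [a_eq, b_eq]
  field_simp
  ring

theorem a_mul_d_add_one (h : Regular t) : a t * d t + 1 = rootAD t ^ 2 := by
  have h₁ := h.shift_ne
  have h₂ := h.quartic_ne
  have h₃ := h.quadratic_ne
  rw [a_eq, d_eq, rootAD]
  field_simp
  simp only [quadratic]
  ring

theorem a_mul_e_add_one (h : Regular t) : a t * e t + 1 = rootAE t ^ 2 := by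
  have h₁ := h.shift_ne
  have h₂ := h.quartic_ne
  have h₃ := h.quadratic_ne
  rw [a_eq, e_eq, rootAE]
  field_simp
  simp only [quadratic]
  ring

theorem c_mul_b_add_one (h : Regular t) : c t * b t + 1 = rootCB t ^ 2 := by
  have h₁ := h.shift_ne
  have h₂ := h.quartic_ne
  have h₃ := h.quadratic_ne
  rw [c_eq, b_eq, rootCB]
  field_simp
  simp only [quartic]
  ring

theorem c_mul_d_add_one (h : Regular t) : c t * d t + 1 = rootCD t ^ 2 := by
  have h₁ := h.shift_ne
  have h₂ := h.quartic_ne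
  have h₃ := h.quadratic_ne
  rw [c_eq, d_eq, rootCD]
  field_simp
  simp only [quartic, quadratic]
  ring

theorem c_mul_e_add_one (h : Regular t) : c t * e t + 1 = rootCE t ^ 2 := by
  have h₁ := h.shift_ne
  have h₂ := h.quartic_ne
  have h₃ := h.quadratic_ne
  rw [c_eq, e_eq, rootCE]
  field_simp
  simp only [quartic, quadratic]
  ring

end Functions

/-! ### Values of the descent maps -/

section Values

variable {K : Type*} [Field K]

/-- The values `x - e₁` of the descent map at the root `e₁ = -d e`, for the points `halfA`, `halfC`,
`halfS`, the point with abscissa `0`, and the two-torsion points with abscissae `e₁`, `e₂`. The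
entry of `(e₁, 0)` is `(e₁ - e₂)(e₁ - e₃)`. -/
def values₁ (t : K) : Fin 6 → K :=
  ![halfDiff (a t) (t + 1) (rootAD t) (rootAE t),
    halfDiff (c t) (rootCB t) (rootCD t) (rootCE t),
    (rootDE t + rootBE t) * (rootDE t + rootBD t),
    d t * e t,
    e t * (b t - d t) * (d t * (b t - e t)),
    e t * (d t - b t)]

/-- The values `x - e₂` of the descent map at the root `e₂ = -b e`, for the same points as in
`values₁`. -/
def values₂ (t : K) : Fin 6 → K :=
  ![halfDiff (a t) (rootAD t) (t + 1) (rootAE t),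
    halfDiff (c t) (rootCD t) (rootCB t) (rootCE t),
    (rootBE t + rootDE t) * (rootBE t + rootBD t),
    b t * e t,
    e t * (b t - d t),
    e t * (d t - b t) * (b t * (d t - e t))]

variable {L : Type*} [Field L] (φ : K →+* L) (t : K)

theorem map_values₁ (i : Fin 6) : φ (values₁ t i) = values₁ (φ t) i := by
  fin_cases i <;>
    simp [values₁, halfDiff, a, b, c, d, e, rootBD, rootBE, rootDE, rootAD, rootAE, rootCB, rootCD,
      rootCE, quartic, quadratic, map_ofNat]

theorem map_values₂ (i : Fin 6) : φ (values₂ t i) = values₂ (φ t) i := by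
  fin_cases i <;>
    simp [values₂, halfDiff, a, b, c, d, e, rootBD, rootBE, rootDE, rootAD, rootAE, rootCB, rootCD,
      rootCE, quartic, quadratic, map_ofNat]

variable {t}

theorem Regular.a_ne [CharZero K] (h : Regular t) : a t ≠ 0 := by
  rw [a_eq]
  exact div_ne_zero h.quartic_ne (mul_ne_zero (mul_ne_zero (by norm_num) h.quadratic_ne) h.shift_ne)

variable {φ}

theorem Regular.of_map (h : Regular (φ t)) : Regular t where
  shift_ne h0 := h.shift_ne (by simpa using congrArg φ h0)
  quartic_ne h0 := h.quartic_ne (by simpa [quartic, map_ofNat] using congrArg φ h0)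
  quadratic_ne h0 := h.quadratic_ne (by simpa [quadratic, map_ofNat] using congrArg φ h0)
  c_ne h0 := h.c_ne (by simpa [c, map_ofNat] using congrArg φ h0)

end Values

/-! ### Continuity of the rational functions -/

section Continuity

variable {L : Type*} [NontriviallyNormedField L]

@[fun_prop]
theorem continuous_quartic : Continuous (quartic : L → L) := by unfold quartic; fun_prop

@[fun_prop]
theorem continuous_quadratic : Continuous (quadratic : L → L) := by unfold quadratic; fun_prop

variable [CharZero L] {t₀ : L}

theorem Regular.continuousAt_a (h : Regular t₀) : ContinuousAt (a : L → L) t₀ := by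
  have h₁ := h.shift_ne
  have h₃ := h.quadratic_ne
  rw [show (a : L → L) = _ from funext fun t => a_eq]
  fun_prop (disch := simp [h₁, h₃])

omit [CharZero L] in
theorem Regular.continuousAt_b (h : Regular t₀) : ContinuousAt (b : L → L) t₀ := by
  have h₂ := h.quartic_ne
  rw [show (b : L → L) = _ from funext fun t => b_eq]
  fun_prop (disch := simp [h₂])

theorem Regular.continuousAt_c (h : Regular t₀) : ContinuousAt (c : L → L) t₀ := by
  have h₂ := h.quartic_ne
  have h₃ := h.quadratic_ne
  rw [show (c : L → L) = _ from funext fun t => c_eq]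
  fun_prop (disch := simp [h₂, h₃])

theorem Regular.continuousAt_d (h : Regular t₀) : ContinuousAt (d : L → L) t₀ := by
  have h₁ := h.shift_ne
  have h₂ := h.quartic_ne
  have h₃ := h.quadratic_ne
  rw [show (d : L → L) = _ from funext fun t => d_eq]
  fun_prop (disch := simp [h₁, h₂, h₃])

theorem Regular.continuousAt_e (h : Regular t₀) : ContinuousAt (e : L → L) t₀ := by
  have h₁ := h.shift_ne
  have h₂ := h.quartic_ne
  have h₃ := h.quadratic_ne
  rw [show (e : L → L) = _ from funext fun t => e_eq]
  fun_prop (disch := simp [h₁, h₂, h₃])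

theorem Regular.continuousAt_roots (h : Regular t₀) :
    ContinuousAt (rootBD : L → L) t₀ ∧ ContinuousAt (rootBE : L → L) t₀ ∧
    ContinuousAt (rootDE : L → L) t₀ ∧ ContinuousAt (rootAD : L → L) t₀ ∧
    ContinuousAt (rootAE : L → L) t₀ ∧ ContinuousAt (rootCB : L → L) t₀ ∧
    ContinuousAt (rootCD : L → L) t₀ ∧ ContinuousAt (rootCE : L → L) t₀ := by
  have h₁ := h.shift_ne
  have h₂ := h.quartic_ne
  have h₃ := h.quadratic_ne
  unfold rootBD rootBE rootDE rootAD rootAE rootCB rootCD rootCE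
  refine ⟨?_, ?_, ?_, ?_, ?_, ?_, ?_, ?_⟩ <;> fun_prop (disch := simp [h₁, h₂, h₃])

theorem Regular.continuousAt_values₁ (h : Regular t₀) (i : Fin 6) :
    ContinuousAt (fun t : L => values₁ t i) t₀ := by
  have ha := h.continuousAt_a
  have hb := h.continuousAt_b
  have hc := h.continuousAt_c
  have hd := h.continuousAt_d
  have he := h.continuousAt_e
  obtain ⟨h₁, h₂, h₃, h₄, h₅, h₆, h₇, h₈⟩ := h.continuousAt_roots
  have ha0 := h.a_ne
  have hc0 := h.c_ne
  fin_cases i <;> simp only [values₁, halfDiff, Fin.zero_eta, Fin.mk_one, Fin.reduceFinMk,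
    Matrix.cons_val] <;> fun_prop (disch := simp [ha0, hc0])

theorem Regular.continuousAt_values₂ (h : Regular t₀) (i : Fin 6) :
    ContinuousAt (fun t : L => values₂ t i) t₀ := by
  have ha := h.continuousAt_a
  have hb := h.continuousAt_b
  have hc := h.continuousAt_c
  have hd := h.continuousAt_d
  have he := h.continuousAt_e
  obtain ⟨h₁, h₂, h₃, h₄, h₅, h₆, h₇, h₈⟩ := h.continuousAt_roots
  have ha0 := h.a_ne
  have hc0 := h.c_ne
  fin_cases i <;> simp only [values₂, halfDiff, Fin.zero_eta, Fin.mk_one, Fin.reduceFinMk,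
    Matrix.cons_val] <;> fun_prop (disch := simp [ha0, hc0])

theorem Regular.eventually (h : Regular t₀) : ∀ᶠ t in 𝓝 t₀, Regular t := by
  have h₁ : ContinuousAt (fun t : L => t + 1) t₀ := by fun_prop
  filter_upwards [h₁.eventually_ne h.shift_ne,
    continuous_quartic.continuousAt.eventually_ne h.quartic_ne,
    continuous_quadratic.continuousAt.eventually_ne h.quadratic_ne,
    h.continuousAt_c.eventually_ne h.c_ne] with t k₁ k₂ k₃ k₄
  exact ⟨k₁, k₂, k₃, k₄⟩

end Continuity

/-! ### Real embeddings with prescribed signs -/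

section Signs

/-- The components of `v` are non-zero, and negative exactly where `σ` is `1`. -/
def HasSigns (v : Fin 6 → ℝ) (σ : Fin 6 → ZMod 2) : Prop :=
  ∀ i, v i ≠ 0 ∧ signBit (v i) = σ i

/-- Near a real point where `v` takes values of prescribed signs there is a transcendental number,
hence a real embedding of `ℚ(t)` giving the same signs. -/
theorem HasSigns.exists_hom {v : ℝ → Fin 6 → ℝ} {w : Fin 6 → RatFunc ℚ} {t₀ : ℝ}
    {σ : Fin 6 → ZMod 2} (h : HasSigns (v t₀) σ) (hc : ∀ i, ContinuousAt (fun t => v t i) t₀)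
    (hreg : Regular t₀) (hmap : ∀ (φ : RatFunc ℚ →+* ℝ) (i : Fin 6), φ (w i) = v (φ RatFunc.X) i) :
    ∃ φ : RatFunc ℚ →+* ℝ, Regular (φ RatFunc.X) ∧ HasSigns (fun i => φ (w i)) σ := by
  obtain ⟨φ, hφ₁, hφ₂⟩ := TripleCurve.exists_hom ℝ (p := fun τ => Regular τ ∧ HasSigns (v τ) σ)
    (hreg.eventually.and (eventually_all.2 fun i =>
      (((hc i).eventually_ne (h i).1).and (eventually_signBit_eq (hc i) (h i).1)).mono
        fun τ hτ => ⟨hτ.1, hτ.2.trans (h i).2⟩))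
  refine ⟨φ, hφ₁, fun i => ?_⟩
  change φ (w i) ≠ 0 ∧ signBit (φ (w i)) = σ i
  rw [hmap]
  exact hφ₂ i

theorem HasSigns.mk {v : Fin 6 → ℝ} {σ : Fin 6 → ZMod 2}
    (h : ∀ i, (v i < 0 ∧ σ i = 1) ∨ (0 < v i ∧ σ i = 0)) : HasSigns v σ := by
  intro i
  rcases h i with ⟨h, hσ⟩ | ⟨h, hσ⟩
  · exact ⟨h.ne, by rw [hσ, signBit_of_neg h]⟩
  · exact ⟨h.ne', by rw [hσ, signBit_of_pos h]⟩

end Signs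

/-! ### Six tables of signs -/

section SignTables

-- The rational numbers `t₀` and the roots are chosen so that the six rows of signs are linearly
-- independent over the field with two elements.

theorem regular_neg_three : Regular (-3 : ℝ) := by
  constructor <;> norm_num [quartic, quadratic, c]

theorem hasSigns_neg_three : HasSigns (values₁ (-3)) ![0, 0, 0, 0, 1, 1] := by
  refine .mk fun i => ?_
  fin_cases i <;> norm_num [values₁, halfDiff, a, b, c, d, e, rootBD, rootBE, rootDE, rootAD,
    rootAE, rootCB, rootCD, rootCE, quartic, quadratic]

theorem regular_neg_four_thirds : Regular (-(4 / 3) : ℝ) := by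
  constructor <;> norm_num [quartic, quadratic, c]

theorem hasSigns_neg_four_thirds : HasSigns (values₁ (-(4 / 3))) ![1, 1, 1, 0, 0, 1] := by
  refine .mk fun i => ?_
  fin_cases i <;> norm_num [values₁, halfDiff, a, b, c, d, e, rootBD, rootBE, rootDE, rootAD,
    rootAE, rootCB, rootCD, rootCE, quartic, quadratic]

theorem regular_neg_five_thirds : Regular (-(5 / 3) : ℝ) := by
  constructor <;> norm_num [quartic, quadratic, c]

theorem hasSigns_neg_five_thirds : HasSigns (values₂ (-(5 / 3))) ![1, 1, 1, 1, 1, 0] := by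
  refine .mk fun i => ?_
  fin_cases i <;> norm_num [values₂, halfDiff, a, b, c, d, e, rootBD, rootBE, rootDE, rootAD,
    rootAE, rootCB, rootCD, rootCE, quartic, quadratic]

theorem regular_neg_third : Regular (-(1 / 3) : ℝ) := by
  constructor <;> norm_num [quartic, quadratic, c]

theorem hasSigns_neg_third : HasSigns (values₂ (-(1 / 3))) ![0, 1, 1, 1, 1, 0] := by
  refine .mk fun i => ?_
  fin_cases i <;> norm_num [values₂, halfDiff, a, b, c, d, e, rootBD, rootBE, rootDE, rootAD,
    rootAE, rootCB, rootCD, rootCE, quartic, quadratic]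

theorem regular_neg_five_quarters : Regular (-(5 / 4) : ℝ) := by
  constructor <;> norm_num [quartic, quadratic, c]

theorem hasSigns_neg_five_quarters : HasSigns (values₁ (-(5 / 4))) ![0, 1, 0, 1, 1, 0] := by
  refine .mk fun i => ?_
  fin_cases i <;> norm_num [values₁, halfDiff, a, b, c, d, e, rootBD, rootBE, rootDE, rootAD,
    rootAE, rootCB, rootCD, rootCE, quartic, quadratic]

theorem regular_neg_eight_fifths : Regular (-(8 / 5) : ℝ) := by
  constructor <;> norm_num [quartic, quadratic, c]

theorem hasSigns_neg_eight_fifths : HasSigns (values₁ (-(8 / 5))) ![0, 0, 1, 1, 0, 1] := by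
  refine .mk fun i => ?_
  fin_cases i <;> norm_num [values₁, halfDiff, a, b, c, d, e, rootBD, rootBE, rootDE, rootAD,
    rootAE, rootCB, rootCD, rootCE, quartic, quadratic]

end SignTables

/-! ### A 2-adic embedding -/

section TwoAdicEmbedding

theorem norm_div_le_one_of_odd {m n : ℤ} (hn : ¬ 2 ∣ n) : ‖(m / n : ℚ_[2])‖ ≤ 1 := by
  have h1 : ‖(n : ℚ_[2])‖ = 1 := by
    refine (Padic.norm_int_le_one n).eq_of_not_lt fun h => hn ?_
    exact_mod_cast Padic.norm_intCast_lt_one_iff.1 h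
  rw [norm_div, h1, div_one]
  exact Padic.norm_int_le_one m

theorem eventually_norm_sub_le {F : ℚ_[2] → ℚ_[2]} {t₀ z : ℚ_[2]} {r : ℝ} (hr : 0 < r)
    (hF : ContinuousAt F t₀) (h : ‖F t₀ - z‖ ≤ r) : ∀ᶠ τ in 𝓝 t₀, ‖F τ - z‖ ≤ r := by
  filter_upwards [Metric.tendsto_nhds.1 hF r hr] with τ hτ
  rw [show F τ - z = (F τ - F t₀) + (F t₀ - z) by ring]
  exact norm_add_le_padic (by rw [← dist_eq_norm]; exact hτ.le) h

theorem regular_neg_three_quarters : Regular (-(3 / 4) : ℚ_[2]) := by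
  constructor <;> norm_num [quartic, quadratic, c]

/-- There is an embedding of `ℚ(t)` in `ℚ_[2]`, with `t` close to `-3/4`, for which the roots of
the curve have the relative positions required by `four_nsmul_eq_zero_of_torsion`. -/
theorem exists_twoAdic_embedding : ∃ φ : RatFunc ℚ →+* ℚ_[2],
    ‖φ (32 ^ 2 * (b RatFunc.X * (e RatFunc.X - d RatFunc.X))) - 4‖ ≤ 1 / 8 ∧
    ‖φ (32 ^ 2 * (e RatFunc.X * (b RatFunc.X - d RatFunc.X))) + 1‖ ≤ 1 / 4 := by
  have hreg := regular_neg_three_quarters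
  have cb := hreg.continuousAt_b
  have cd := hreg.continuousAt_d
  have ce := hreg.continuousAt_e
  have vb : b (-(3 / 4) : ℚ_[2]) = 105 / 58 := by norm_num [b]
  have vd : d (-(3 / 4) : ℚ_[2]) = 1287 / 1624 := by norm_num [d]
  have ve : e (-(3 / 4) : ℚ_[2]) = -(7905 / 25984) := by norm_num [e]
  have n₁ := norm_div_le_one_of_odd (m := -214148) (n := 841) (by norm_num)
  have n₂ := norm_div_le_one_of_odd (m := -112291) (n := 1421) (by norm_num)
  push_cast at n₁ n₂
  have h₁ := eventually_norm_sub_le (F := fun t => 32 ^ 2 * (b t * (e t - d t))) (z := 4)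
    (t₀ := -(3 / 4)) (r := 1 / 8) (by norm_num) (by fun_prop) (by
      simp only [vb, vd, ve]
      rw [show (32 : ℚ_[2]) ^ 2 * (105 / 58 * (-(7905 / 25984) - 1287 / 1624)) - 4 =
        2 * 4 * (-214148 / 841) by norm_num, norm_mul, norm_mul, norm_two_padic, norm_four_padic]
      linarith)
  have h₂ := eventually_norm_sub_le (F := fun t => 32 ^ 2 * (e t * (b t - d t))) (z := -1)
    (t₀ := -(3 / 4)) (r := 1 / 4) (by norm_num) (by fun_prop) (by
      simp only [vb, vd, ve]
      rw [show (32 : ℚ_[2]) ^ 2 * (-(7905 / 25984) * (105 / 58 - 1287 / 1624)) - -1 =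
        4 * (-112291 / 1421) by norm_num, norm_mul, norm_four_padic]
      linarith)
  obtain ⟨φ, hφ₁, hφ₂⟩ := exists_hom ℚ_[2] (h₁.and h₂)
  have mb : φ (b RatFunc.X) = b (φ RatFunc.X) := by simp [b, map_ofNat]
  have md : φ (d RatFunc.X) = d (φ RatFunc.X) := by simp [d, map_ofNat]
  have me : φ (e RatFunc.X) = e (φ RatFunc.X) := by simp [e, map_ofNat]
  refine ⟨φ, ?_, ?_⟩
  · simpa only [map_mul, map_sub, map_pow, map_ofNat, mb, md, me] using hφ₁
  · simpa only [map_mul, map_sub, map_pow, map_ofNat, mb, md, me, sub_neg_eq_add] using hφ₂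

end TwoAdicEmbedding

/-! ### The curve over the field of rational functions -/

local notation "𝐭" => (RatFunc.X : RatFunc ℚ)

section Curve

theorem regular_X : Regular 𝐭 := by
  obtain ⟨φ, hφ, -⟩ := hasSigns_neg_three.exists_hom regular_neg_three.continuousAt_values₁
    regular_neg_three fun φ i => map_values₁ φ 𝐭 i
  exact hφ.of_map

theorem values₁_ne_zero (i : Fin 6) : values₁ 𝐭 i ≠ 0 := by
  obtain ⟨φ, -, hφ⟩ := hasSigns_neg_three.exists_hom regular_neg_three.continuousAt_values₁
    regular_neg_three fun φ i => map_values₁ φ 𝐭 i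
  exact fun h => (hφ i).1 (by simp only [h, map_zero])

theorem values₂_ne_zero (i : Fin 6) : values₂ 𝐭 i ≠ 0 := by
  obtain ⟨φ, -, hφ⟩ := hasSigns_neg_five_thirds.exists_hom
    regular_neg_five_thirds.continuousAt_values₂ regular_neg_five_thirds
    fun φ i => map_values₂ φ 𝐭 i
  exact fun h => (hφ i).1 (by simp only [h, map_zero])

/-- The three roots `e₁ = -d e`, `e₂ = -b e`, `e₃ = -b d` of the Weierstrass model. -/
theorem splitBy_E : SplitBy E (-(d 𝐭 * e 𝐭)) (-(b 𝐭 * e 𝐭)) (-(b 𝐭 * d 𝐭)) where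
  a₁ := rfl
  a₂ := by simp only [E, weierstrass]; ring
  a₃ := rfl
  a₄ := by simp only [E, weierstrass]; ring
  a₆ := by simp only [E, weierstrass]; ring

theorem b_mul_e_ne : b 𝐭 * e 𝐭 ≠ 0 := values₂_ne_zero 3

theorem d_mul_e_ne : d 𝐭 * e 𝐭 ≠ 0 := values₁_ne_zero 3

theorem bde_ne_zero : bde ≠ 0 :=
  mul_ne_zero (mul_ne_zero (left_ne_zero_of_mul b_mul_e_ne) (left_ne_zero_of_mul d_mul_e_ne))
    (right_ne_zero_of_mul d_mul_e_ne)

theorem root₁_ne_root₂ : -(d 𝐭 * e 𝐭) ≠ -(b 𝐭 * e 𝐭) := fun h =>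
  values₁_ne_zero 5 (by change e 𝐭 * (d 𝐭 - b 𝐭) = 0; linear_combination -h)

theorem root₁_ne_root₃ : -(d 𝐭 * e 𝐭) ≠ -(b 𝐭 * d 𝐭) := fun h =>
  right_ne_zero_of_mul (values₁_ne_zero 4) (by linear_combination h)

theorem root₂_ne_root₃ : -(b 𝐭 * e 𝐭) ≠ -(b 𝐭 * d 𝐭) := fun h =>
  right_ne_zero_of_mul (values₂_ne_zero 5) (by linear_combination h)

theorem E_Δ_ne_zero : E.Δ ≠ 0 := by
  rw [splitBy_E.Δ]
  exact mul_ne_zero (by norm_num) (pow_ne_zero 2 (mul_ne_zero (mul_ne_zero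
    (sub_ne_zero.2 root₁_ne_root₂) (sub_ne_zero.2 root₁_ne_root₃)) (sub_ne_zero.2 root₂_ne_root₃)))

theorem nonsingular_iff (x y : RatFunc ℚ) : E.Nonsingular x y ↔
    y ^ 2 = (x + d 𝐭 * e 𝐭) * (x + b 𝐭 * e 𝐭) * (x + b 𝐭 * d 𝐭) := by
  rw [← equation_iff_nonsingular_of_Δ_ne_zero E_Δ_ne_zero, splitBy_E.equation_iff]
  simp only [sub_neg_eq_add]

end Curve

/-! ### The points independent modulo two, and the torsion subgroup -/

section Generators

theorem a_X_ne_zero : a 𝐭 ≠ 0 := regular_X.a_ne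

theorem c_X_ne_zero : c 𝐭 ≠ 0 := regular_X.c_ne

/-- Half of the difference of the points with abscissae `a(t)` and `0`. -/
noncomputable def halfA : E.Point :=
  .some (-(d 𝐭 * e 𝐭) + halfDiff (a 𝐭) (𝐭 + 1) (rootAD 𝐭) (rootAE 𝐭))
    (halfY (a 𝐭) (𝐭 + 1) (rootAD 𝐭) (rootAE 𝐭))
    ((equation_iff_nonsingular_of_Δ_ne_zero E_Δ_ne_zero).1 (splitBy_E.equation_half a_X_ne_zero
      (a_mul_b_add_one regular_X) (a_mul_d_add_one regular_X) (a_mul_e_add_one regular_X)))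

/-- Half of the difference of the points with abscissae `c(t)` and `0`. -/
noncomputable def halfC : E.Point :=
  .some (-(d 𝐭 * e 𝐭) + halfDiff (c 𝐭) (rootCB 𝐭) (rootCD 𝐭) (rootCE 𝐭))
    (halfY (c 𝐭) (rootCB 𝐭) (rootCD 𝐭) (rootCE 𝐭))
    ((equation_iff_nonsingular_of_Δ_ne_zero E_Δ_ne_zero).1 (splitBy_E.equation_half c_X_ne_zero
      (c_mul_b_add_one regular_X) (c_mul_d_add_one regular_X) (c_mul_e_add_one regular_X)))

/-- Half of the point with abscissa `1 / (b d e)` on the cubic. -/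
noncomputable def halfS : E.Point :=
  .some (1 + rootDE 𝐭 * rootBE 𝐭 + rootDE 𝐭 * rootBD 𝐭 + rootBE 𝐭 * rootBD 𝐭)
    ((rootDE 𝐭 + rootBE 𝐭) * (rootDE 𝐭 + rootBD 𝐭) * (rootBE 𝐭 + rootBD 𝐭))
    ((nonsingular_iff _ _).2 (by
      have h₁ := d_mul_e_add_one regular_X
      have h₂ := b_mul_e_add_one regular_X
      have h₃ := b_mul_d_add_one regular_X
      rw [← eq_sub_iff_add_eq] at h₁ h₂ h₃
      rw [h₁, h₂, h₃]
      ring))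

/-- The point with abscissa `0`. -/
noncomputable def base : E.Point :=
  .some 0 (-(b 𝐭 * d 𝐭 * e 𝐭)) ((nonsingular_iff _ _).2 (by ring))

/-- The two-torsion point `(e₁, 0)`. -/
noncomputable def torsion₁ : E.Point :=
  .some (-(d 𝐭 * e 𝐭)) 0 ((nonsingular_iff _ _).2 (by ring))

/-- The two-torsion point `(e₂, 0)`. -/
noncomputable def torsion₂ : E.Point :=
  .some (-(b 𝐭 * e 𝐭)) 0 ((nonsingular_iff _ _).2 (by ring))

/-- Six points whose classes modulo `2` are independent. -/
noncomputable def generator : Fin 6 → E.Point := ![halfA, halfC, halfS, base, torsion₁, torsion₂]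

theorem descentFun_of_eq_add {K : Type*} [Field K] {W : WeierstrassCurve.Affine K} {e₁ e₂ e₃ : K}
    {χ : K → ZMod 2} {x y z : K} (h : W.Nonsingular x y) (hz : x = e₁ + z) (hz0 : z ≠ 0) :
    descentFun χ e₁ e₂ e₃ (Point.some _ _ h) = χ z := by
  rw [descentFun_some h (by rw [hz]; simpa using hz0), hz, add_sub_cancel_left]

theorem descentFun_generator₁ (χ : RatFunc ℚ → ZMod 2) (i : Fin 6) :
    descentFun χ (-(d 𝐭 * e 𝐭)) (-(b 𝐭 * e 𝐭)) (-(b 𝐭 * d 𝐭)) (generator i) =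
      χ (values₁ 𝐭 i) := by
  have h := values₁_ne_zero i
  fin_cases i
  · exact descentFun_of_eq_add _ rfl h
  · exact descentFun_of_eq_add _ rfl h
  · refine descentFun_of_eq_add _ ?_ h
    change _ = -(d 𝐭 * e 𝐭) + (rootDE 𝐭 + rootBE 𝐭) * (rootDE 𝐭 + rootBD 𝐭)
    linear_combination d_mul_e_add_one regular_X
  · refine descentFun_of_eq_add _ ?_ h
    exact (neg_add_cancel _).symm
  · refine (descentFun_root _).trans (congrArg χ ?_)
    change _ = e 𝐭 * (b 𝐭 - d 𝐭) * (d 𝐭 * (b 𝐭 - e 𝐭))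
    ring
  · refine descentFun_of_eq_add _ ?_ h
    change _ = -(d 𝐭 * e 𝐭) + e 𝐭 * (d 𝐭 - b 𝐭)
    ring

theorem descentFun_generator₂ (χ : RatFunc ℚ → ZMod 2) (i : Fin 6) :
    descentFun χ (-(b 𝐭 * e 𝐭)) (-(d 𝐭 * e 𝐭)) (-(b 𝐭 * d 𝐭)) (generator i) =
      χ (values₂ 𝐭 i) := by
  have h := values₂_ne_zero i
  fin_cases i
  · exact descentFun_of_eq_add _ (halfDiff_swap a_X_ne_zero (a_mul_b_add_one regular_X)
      (a_mul_d_add_one regular_X) (a_mul_e_add_one regular_X)) h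
  · exact descentFun_of_eq_add _ (halfDiff_swap c_X_ne_zero (c_mul_b_add_one regular_X)
      (c_mul_d_add_one regular_X) (c_mul_e_add_one regular_X)) h
  · refine descentFun_of_eq_add _ ?_ h
    change _ = -(b 𝐭 * e 𝐭) + (rootBE 𝐭 + rootDE 𝐭) * (rootBE 𝐭 + rootBD 𝐭)
    linear_combination b_mul_e_add_one regular_X
  · refine descentFun_of_eq_add _ ?_ h
    exact (neg_add_cancel _).symm
  · refine descentFun_of_eq_add _ ?_ h
    change _ = -(b 𝐭 * e 𝐭) + e 𝐭 * (b 𝐭 - d 𝐭)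
    ring
  · refine (descentFun_root _).trans (congrArg χ ?_)
    change _ = e 𝐭 * (d 𝐭 - b 𝐭) * (b 𝐭 * (d 𝐭 - e 𝐭))
    ring

variable [DecidableEq (RatFunc ℚ)]

theorem exists_character₁ {t₀ : ℝ} {σ : Fin 6 → ZMod 2} (hreg : Regular t₀)
    (hs : HasSigns (values₁ t₀) σ) :
    ∃ f : E.Point →+ ZMod 2, ∀ i, f (generator i) = σ i := by
  obtain ⟨φ, -, hφ⟩ := hs.exists_hom hreg.continuousAt_values₁ hreg fun φ i => map_values₁ φ 𝐭 i
  exact ⟨descentHom (χ := fun z => signBit (φ z)) splitBy_E (signBit_comp_mul φ)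
    root₁_ne_root₂ root₁_ne_root₃ root₂_ne_root₃,
    fun i => (descentFun_generator₁ (fun z => signBit (φ z)) i).trans (hφ i).2⟩

theorem exists_character₂ {t₀ : ℝ} {σ : Fin 6 → ZMod 2} (hreg : Regular t₀)
    (hs : HasSigns (values₂ t₀) σ) :
    ∃ f : E.Point →+ ZMod 2, ∀ i, f (generator i) = σ i := by
  obtain ⟨φ, -, hφ⟩ := hs.exists_hom hreg.continuousAt_values₂ hreg fun φ i => map_values₂ φ 𝐭 i
  exact ⟨descentHom (χ := fun z => signBit (φ z)) splitBy_E.swap (signBit_comp_mul φ)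
    root₁_ne_root₂.symm root₂_ne_root₃ root₁_ne_root₃,
    fun i => (descentFun_generator₂ (fun z => signBit (φ z)) i).trans (hφ i).2⟩

/-- The six points are independent modulo `2`: six real characters separate their combinations. -/
theorem even_of_sum_eq {n : Fin 6 → ℤ} {P : E.Point}
    (h : ∑ i, n i • generator i = (2 : ℕ) • P) (i : Fin 6) : 2 ∣ n i := by
  have two : ∀ z : ZMod 2, (2 : ℕ) • z = 0 := by decide
  have key : ∀ f : E.Point →+ ZMod 2, ∑ i, (n i : ZMod 2) * f (generator i) = 0 := fun f => by
    have := congrArg f h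
    rw [map_sum, map_nsmul, two] at this
    simpa only [map_zsmul, zsmul_eq_mul] using this
  obtain ⟨f₁, h₁⟩ := exists_character₁ regular_neg_three hasSigns_neg_three
  obtain ⟨f₂, h₂⟩ := exists_character₁ regular_neg_four_thirds hasSigns_neg_four_thirds
  obtain ⟨f₃, h₃⟩ := exists_character₂ regular_neg_five_thirds hasSigns_neg_five_thirds
  obtain ⟨f₄, h₄⟩ := exists_character₂ regular_neg_third hasSigns_neg_third
  obtain ⟨f₅, h₅⟩ := exists_character₁ regular_neg_five_quarters hasSigns_neg_five_quarters
  obtain ⟨f₆, h₆⟩ := exists_character₁ regular_neg_eight_fifths hasSigns_neg_eight_fifths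
  have k₁ := key f₁
  have k₂ := key f₂
  have k₃ := key f₃
  have k₄ := key f₄
  have k₅ := key f₅
  have k₆ := key f₆
  simp only [h₁, h₂, h₃, h₄, h₅, h₆, Fin.sum_univ_six, Matrix.cons_val, mul_one, mul_zero,
    add_zero, zero_add] at k₁ k₂ k₃ k₄ k₅ k₆
  refine (ZMod.intCast_zmod_eq_zero_iff_dvd _ 2).1 ?_
  have solve : ∀ x₀ x₁ x₂ x₃ x₄ x₅ : ZMod 2, x₄ + x₅ = 0 → x₀ + x₁ + x₂ + x₅ = 0 →
      x₀ + x₁ + x₂ + x₃ + x₄ = 0 → x₁ + x₂ + x₃ + x₄ = 0 → x₁ + x₃ + x₄ = 0 →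
      x₂ + x₃ + x₅ = 0 → x₀ = 0 ∧ x₁ = 0 ∧ x₂ = 0 ∧ x₃ = 0 ∧ x₄ = 0 ∧ x₅ = 0 := by decide
  obtain ⟨z₀, z₁, z₂, z₃, z₄, z₅⟩ := solve _ _ _ _ _ _ k₁ k₂ k₃ k₄ k₅ k₆
  fin_cases i <;> assumption

theorem sum_generator (n : Fin 6 → ℤ) : ∑ i, n i • generator i =
    n 0 • halfA + n 1 • halfC + n 2 • halfS + n 3 • base + n 4 • torsion₁ + n 5 • torsion₂ := by
  rw [Fin.sum_univ_six]
  rfl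

theorem two_nsmul_torsion₁ : (2 : ℕ) • torsion₁ = 0 := splitBy_E.two_nsmul_eq_zero _ rfl

theorem two_nsmul_torsion₂ : (2 : ℕ) • torsion₂ = 0 := splitBy_E.two_nsmul_eq_zero _ rfl

/-- The points killed by two are the combinations of the two-torsion points. -/
theorem exists_eq_of_two_nsmul_eq_zero {P : E.Point} (hP : (2 : ℕ) • P = 0) :
    ∃ k l : ℤ, P = k • torsion₁ + l • torsion₂ := by
  rcases P with _ | ⟨x, y, h⟩
  · exact ⟨0, 0, by rw [zero_zsmul, zero_zsmul, add_zero]; rfl⟩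
  have hy : y = 0 := by
    by_contra hy
    obtain ⟨x', y', h', hPP, -⟩ := splitBy_E.exists_double h (mul_ne_zero two_ne_zero hy)
    exact Point.some_ne_zero h' (hPP.symm.trans hP)
  subst hy
  rcases splitBy_E.eq_root_of_y_eq_zero h rfl with rfl | rfl | rfl
  · exact ⟨1, 0, by rw [one_zsmul, zero_zsmul, add_zero]; rfl⟩
  · exact ⟨0, 1, by rw [one_zsmul, zero_zsmul, zero_add]; rfl⟩
  · refine ⟨1, 1, ?_⟩
    rw [one_smul, one_smul]
    exact (splitBy_E.add_eq (ℓ := 0) _ _ h root₁_ne_root₂ (by ring) (by ring) (by ring)).symm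

/-- All torsion is killed by two: a torsion point is killed by `4`, and by descent the nonzero
points killed by two are not divisible by two. -/
theorem two_nsmul_eq_zero_of_torsion {P : E.Point} (hP : IsOfFinAddOrder P) :
    (2 : ℕ) • P = 0 := by
  obtain ⟨φ, hδ, hu⟩ := exists_twoAdic_embedding
  -- `32 ^ 2` clears the power `2 ^ (-10)` of two in `e₁ - e₂` at `t = -3/4`.
  have h4 : (4 : ℕ) • P = 0 := by
    refine four_nsmul_eq_zero_of_torsion (φ := φ) (c := 32) splitBy_E.rotate (by norm_num) ?_ ?_ hP
    · convert hδ using 4; ring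
    · convert hu using 4; ring
  obtain ⟨k, l, hkl⟩ := exists_eq_of_two_nsmul_eq_zero (P := (2 : ℕ) • P)
    (by rw [← mul_smul]; exact h4)
  have heven := even_of_sum_eq (n := ![0, 0, 0, 0, k, l]) (P := P)
    (by rw [sum_generator, hkl]; simp)
  obtain ⟨k', rfl⟩ := heven 4
  obtain ⟨l', rfl⟩ := heven 5
  have double : ∀ (k : ℤ) {T : E.Point}, (2 : ℕ) • T = 0 → (2 * k) • T = 0 := fun k T hT => by
    rw [mul_comm, mul_smul, two_zsmul, ← two_nsmul, hT, zsmul_zero]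
  rw [hkl]
  exact (congrArg₂ _ (double k' two_nsmul_torsion₁) (double l' two_nsmul_torsion₂)).trans
    (add_zero _)

theorem linearIndependent_generator :
    LinearIndependent ℤ ![halfA, halfC, halfS, base] := by
  refine linearIndependent_of_even fun m hm => ?_
  obtain ⟨k, l, hkl⟩ := exists_eq_of_two_nsmul_eq_zero (two_nsmul_eq_zero_of_torsion hm)
  have heven := even_of_sum_eq (n := ![m 0, m 1, m 2, m 3, -k, -l]) (P := 0) (by
    rw [Fin.sum_univ_four] at hkl
    simp only [Matrix.cons_val] at hkl
    rw [sum_generator, nsmul_zero]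
    simp only [Matrix.cons_val]
    rw [hkl]
    simp only [neg_smul]
    abel)
  intro i
  fin_cases i
  · exact heven 0
  · exact heven 1
  · exact heven 2
  · exact heven 3

/-- The torsion subgroup consists of the four combinations of the two-torsion points. -/
theorem nonempty_torsion_equiv :
    Nonempty (AddCommGroup.torsion E.Point ≃+ ZMod 2 × ZMod 2) := by
  have mem : ∀ {P : E.Point}, (2 : ℕ) • P = 0 → P ∈ AddCommGroup.torsion E.Point := fun h =>
    isOfFinAddOrder_iff_nsmul_eq_zero.2 ⟨2, two_pos, h⟩
  let T₁ : AddCommGroup.torsion E.Point := ⟨torsion₁, mem two_nsmul_torsion₁⟩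
  let T₂ : AddCommGroup.torsion E.Point := ⟨torsion₂, mem two_nsmul_torsion₂⟩
  have hT₁ : (zmultiplesHom (AddCommGroup.torsion E.Point) T₁) (2 : ℕ) = 0 := by
    rw [zmultiplesHom_apply, natCast_zsmul]
    exact Subtype.ext two_nsmul_torsion₁
  have hT₂ : (zmultiplesHom (AddCommGroup.torsion E.Point) T₂) (2 : ℕ) = 0 := by
    rw [zmultiplesHom_apply, natCast_zsmul]
    exact Subtype.ext two_nsmul_torsion₂
  let g : ZMod 2 × ZMod 2 →+ AddCommGroup.torsion E.Point :=
    (ZMod.lift 2 ⟨_, hT₁⟩).coprod (ZMod.lift 2 ⟨_, hT₂⟩)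
  have hg : ∀ k l : ℤ, g (k, l) = k • T₁ + l • T₂ := fun k l => by
    simp only [g, AddMonoidHom.coprod_apply, ZMod.lift_coe, zmultiplesHom_apply]
  refine ⟨(AddEquiv.ofBijective g ⟨?_, ?_⟩).symm⟩
  · rw [injective_iff_map_eq_zero]
    rintro ⟨x, y⟩ hxy
    obtain ⟨k, rfl⟩ := ZMod.intCast_surjective x
    obtain ⟨l, rfl⟩ := ZMod.intCast_surjective y
    rw [hg] at hxy
    have h0 : k • torsion₁ + l • torsion₂ = 0 := congrArg Subtype.val hxy
    have heven := even_of_sum_eq (n := ![0, 0, 0, 0, k, l]) (P := 0)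
      (by rw [sum_generator, nsmul_zero, ← h0]; simp)
    exact Prod.ext ((ZMod.intCast_zmod_eq_zero_iff_dvd k 2).2 (heven 4))
      ((ZMod.intCast_zmod_eq_zero_iff_dvd l 2).2 (heven 5))
  · rintro ⟨P, hP⟩
    obtain ⟨k, l, hkl⟩ := exists_eq_of_two_nsmul_eq_zero (two_nsmul_eq_zero_of_torsion hP)
    exact ⟨(k, l), by rw [hg]; exact Subtype.ext hkl.symm⟩

end Generators

/-! ### The four points on the cubic -/

section Points

/-- The ordinates of the four points on the cubic. With these signs the second and third points
differ from the first by the doubles of `halfA` and `halfC`. -/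
noncomputable def yCoord : Fin 4 → RatFunc ℚ :=
  ![-1, (𝐭 + 1) * rootAD 𝐭 * rootAE 𝐭, rootCB 𝐭 * rootCD 𝐭 * rootCE 𝐭,
    rootDE 𝐭 * rootBE 𝐭 * rootBD 𝐭 / bde]

theorem onCubic_xCoord (i : Fin 4) :
    OnCubic (b 𝐭) (d 𝐭) (e 𝐭) (xCoord i) (yCoord i) := by
  have hr := regular_X
  fin_cases i
  · change (-1 : RatFunc ℚ) ^ 2 = (b 𝐭 * 0 + 1) * (d 𝐭 * 0 + 1) * (e 𝐭 * 0 + 1)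
    ring
  · change ((𝐭 + 1) * rootAD 𝐭 * rootAE 𝐭) ^ 2 =
      (b 𝐭 * a 𝐭 + 1) * (d 𝐭 * a 𝐭 + 1) * (e 𝐭 * a 𝐭 + 1)
    rw [mul_comm (b 𝐭), mul_comm (d 𝐭), mul_comm (e 𝐭), a_mul_b_add_one hr, a_mul_d_add_one hr,
      a_mul_e_add_one hr]
    ring
  · change (rootCB 𝐭 * rootCD 𝐭 * rootCE 𝐭) ^ 2 =
      (b 𝐭 * c 𝐭 + 1) * (d 𝐭 * c 𝐭 + 1) * (e 𝐭 * c 𝐭 + 1)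
    rw [mul_comm (b 𝐭), mul_comm (d 𝐭), mul_comm (e 𝐭), c_mul_b_add_one hr, c_mul_d_add_one hr,
      c_mul_e_add_one hr]
    ring
  · rw [onCubic_iff (show b 𝐭 * d 𝐭 * e 𝐭 ≠ 0 from bde_ne_zero), weierstrass_equation_iff]
    change (bde * (rootDE 𝐭 * rootBE 𝐭 * rootBD 𝐭 / bde)) ^ 2 = (bde * (1 / bde) + d 𝐭 * e 𝐭) *
      (bde * (1 / bde) + b 𝐭 * e 𝐭) * (bde * (1 / bde) + b 𝐭 * d 𝐭)
    rw [mul_div_cancel₀ _ bde_ne_zero, mul_one_div_cancel bde_ne_zero, add_comm 1, add_comm 1,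
      add_comm 1, d_mul_e_add_one hr, b_mul_e_add_one hr, b_mul_d_add_one hr]
    ring

theorem nonsingular_xCoord (i : Fin 4) : E.Nonsingular (bde * xCoord i) (bde * yCoord i) :=
  (equation_iff_nonsingular_of_Δ_ne_zero E_Δ_ne_zero).1
    ((onCubic_iff (show b 𝐭 * d 𝐭 * e 𝐭 ≠ 0 from bde_ne_zero) _ _).1 (onCubic_xCoord i))

/-- The four points on the Weierstrass model. -/
noncomputable def point (i : Fin 4) : E.Point := .some _ _ (nonsingular_xCoord i)

theorem point_zero : point 0 = base := by
  rw [point, base, Point.some.injEq]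
  exact ⟨mul_zero _, mul_neg_one _⟩

variable [DecidableEq (RatFunc ℚ)]

theorem point_one : point 1 = base + (2 : ℕ) • halfA :=
  some_eq_add_two_nsmul splitBy_E E_Δ_ne_zero a_X_ne_zero bde_ne_zero (a_mul_b_add_one regular_X)
    (a_mul_d_add_one regular_X) (a_mul_e_add_one regular_X) rfl rfl
    (mul_ne_zero two_ne_zero (halfY_ne_zero (values₁_ne_zero 0) (values₂_ne_zero 0))) _
    (nonsingular_xCoord 1) _

theorem point_two : point 2 = base + (2 : ℕ) • halfC :=
  some_eq_add_two_nsmul splitBy_E E_Δ_ne_zero c_X_ne_zero bde_ne_zero (c_mul_b_add_one regular_X)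
    (c_mul_d_add_one regular_X) (c_mul_e_add_one regular_X) rfl rfl
    (mul_ne_zero two_ne_zero (halfY_ne_zero (values₁_ne_zero 1) (values₂_ne_zero 1))) _
    (nonsingular_xCoord 2) _

theorem point_three : point 3 = (2 : ℕ) • halfS := by
  have hx : bde * xCoord 3 = 1 := mul_one_div_cancel bde_ne_zero
  have hy : bde * yCoord 3 = rootDE 𝐭 * rootBE 𝐭 * rootBD 𝐭 := mul_div_cancel₀ _ bde_ne_zero
  refine (splitBy_E.two_nsmul_half _ (nonsingular_xCoord 3) ?_ (u₁ := rootDE 𝐭) (u₂ := rootBE 𝐭)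
    (u₃ := rootBD 𝐭) ?_ ?_ ?_ ?_ rfl hy).symm
  · exact mul_ne_zero two_ne_zero (mul_ne_zero (values₁_ne_zero 2)
      (right_ne_zero_of_mul (values₂_ne_zero 2)))
  · rw [hx]; linear_combination d_mul_e_add_one regular_X
  · rw [hx]; linear_combination b_mul_e_add_one regular_X
  · rw [hx]; linear_combination b_mul_d_add_one regular_X
  · rw [hx]

theorem linearIndependent_point : LinearIndependent ℤ point := by
  have h := Fintype.linearIndependent_iff.1 linearIndependent_generator
  rw [Fintype.linearIndependent_iff]
  intro n hn
  rw [Fin.sum_univ_four, point_zero, point_one, point_two, point_three] at hn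
  have h' := h ![2 * n 1, 2 * n 2, 2 * n 3, n 0 + n 1 + n 2] (by
    rw [Fin.sum_univ_four, ← hn]
    simp only [Matrix.cons_val]
    module)
  have h₁ : 2 * n 1 = 0 := h' 0
  have h₂ : 2 * n 2 = 0 := h' 1
  have h₃ : 2 * n 3 = 0 := h' 2
  have h₀ : n 0 + n 1 + n 2 = 0 := h' 3
  intro i
  fin_cases i
  · change n 0 = 0; omega
  · change n 1 = 0; omega
  · change n 2 = 0; omega
  · change n 3 = 0; omega

end Points

end TripleCurve

theorem theorem1 [DecidableEq (RatFunc ℚ)] :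
    -- the cubic is an elliptic curve, with Weierstrass form `E` via `(x, y) ↦ (bde x, bde y)`
    TripleCurve.bde ≠ 0 ∧
    TripleCurve.E.IsElliptic ∧
    (∀ x y : RatFunc ℚ,
      TripleCurve.OnCubic (TripleCurve.b RatFunc.X) (TripleCurve.d RatFunc.X)
          (TripleCurve.e RatFunc.X) x y ↔
        TripleCurve.E.Equation (TripleCurve.bde * x) (TripleCurve.bde * y)) ∧
    -- the torsion group
    Nonempty (AddCommGroup.torsion TripleCurve.E.Point ≃+ ZMod 2 × ZMod 2) ∧
    -- the rank
    4 ≤ Module.rank ℤ TripleCurve.E.Point ∧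
    -- four independent points with the given `x`-coordinates on the cubic
    ∃ (y : Fin 4 → RatFunc ℚ) (P : Fin 4 → TripleCurve.E.Point),
      (∀ i, TripleCurve.OnCubic (TripleCurve.b RatFunc.X) (TripleCurve.d RatFunc.X)
        (TripleCurve.e RatFunc.X) (TripleCurve.xCoord i) (y i)) ∧
      (∀ i, ∃ h : TripleCurve.E.Nonsingular (TripleCurve.bde * TripleCurve.xCoord i)
          (TripleCurve.bde * y i),
        P i = WeierstrassCurve.Affine.Point.some _ _ h) ∧
      LinearIndependent ℤ P := by
  refine ⟨TripleCurve.bde_ne_zero, ⟨isUnit_iff_ne_zero.2 TripleCurve.E_Δ_ne_zero⟩,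
    TripleCurve.onCubic_iff TripleCurve.bde_ne_zero, TripleCurve.nonempty_torsion_equiv, ?_,
    TripleCurve.yCoord, TripleCurve.point, TripleCurve.onCubic_xCoord,
    fun i => ⟨TripleCurve.nonsingular_xCoord i, rfl⟩, TripleCurve.linearIndependent_point⟩
  simpa using TripleCurve.linearIndependent_point.cardinal_le_rank
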